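/- For $\lambda\in\mathbb C$, $c\in\mathbb R$ let $\Sigma(\lambda;c)=c^2\lambda^2-10(\cosh\lambda-1)+2(\cosh 2\lambda-1)$. Let $c^\ast>1$ and $k_0>0$ be such that the purely imaginary roots of $\Sigma(\cdot;c^\ast)$ are exactly $0,\pm ik_0$, each of multiplicity two. Let $\mathcal V$ be an open neighborhood of $c^\ast$ and $p_0,s_0\colon\mathcal V\to\mathbb R$ smooth functions with $p_0(c^\ast)=s_0(c^\ast)=0$ such that, for $c\in\mathcal V$, both numbers $\pm\sqrt{s_0(c)}+i(k_0+p_0(c))$ are roots of $\Sigma(\cdot;c)$. Let $\mathcal U\subset\mathbb C^2$ and $\mathcal Z\subset\mathbb R$ be open neighborhoods of $0$, and consider for $(A,B)\in\mathcal U$ and parameters $(c,D)\in\mathcal V\times\mathcal Z$ the system $$\partial_\xi A=ik_0A+B+iA\,\mathcal R_{c,D}(I,J)+\rho_1(A,B;c,D),$$ $$\partial_\xi B=ik_0B+iB\,\mathcal R_{c,D}(I,J)+A\,\mathcal S_{c,D}(I,J)+\rho_2(A,B;c,D),$$ with $I=|A|^2$, $J=i(A\overline B-\overline AB)$, where $\mathcal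 R_{c,D},\mathcal S_{c,D}$ are real affine linear functions of $(I,J)$, with $C^3$-coefficients in $(c,D)\in\mathcal V\times\mathcal Z$, satisfying $$\mathcal R_{c,D}(I,J)=p_0(c)+rI+fJ+\mathcal O\big(|D|+|c-c^\ast|(|I|+|J|)\big),$$ $$\mathcal S_{c,D}(I,J)=s_0(c)+sI+gJ+\mathcal O\big(|D|+|c-c^\ast|(|I|+|J|)\big)$$ as $(c,D,I,J)\to(c^\ast,0,0,0)$, with $r,s,f,g\in\mathbb R$ and $s<0$. The remainder $\rho=(\rho_1,\rho_2)$ is $C^6$ (in the real sense) on $\mathcal U\times\mathcal V\times\mathcal Z$ and, with $X=(A,B)$, satisfies $$\rho=\mathcal O\big(\|X\|^4+\|X\||D|(\|X\|^2+|D|^2)\big)$$ near $(0,0;c^\ast,0)$. Suppose the system is reversible under $\widetilde R(A,B)=(\overline A,-\overline B)$, that is, its vector field $F$ satisfies $F(\widetilde RX;c,D)=-\widetilde RF(X;c,D)$ whenever $X,\widetilde RX\in\mathcal U$. Then there exist $C,\delta>0$ such that for every $c\in(c^\ast,c^\ast+\delta)$ one has $c\in\mathcal V$, $s_0(c)>0$,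 and the full system with $D=0$ has two distinct solutions $(\widetilde A_{\theta^\ast},\widetilde B_{\theta^\ast})\colon\mathbb R\to\mathcal U$, $\theta^\ast\in\{0,\pi\}$, which are nontrivial, are reversible (i.e. $(\widetilde A_{\theta^\ast},\widetilde B_{\theta^\ast})(-\xi)=\widetilde R(\widetilde A_{\theta^\ast},\widetilde B_{\theta^\ast})(\xi)$ for all $\xi$), converge to $(0,0)$ as $\xi\to\pm\infty$, and satisfy $$|\widetilde A_{\theta^\ast}(\xi)-A_{\theta^\ast}(\xi)|\le C|c-c^\ast|,\qquad |\widetilde B_{\theta^\ast}(\xi)-B_{\theta^\ast}(\xi)|\le C|c-c^\ast|\qquad(\xi\in\mathbb R),$$ where $$A_\theta(\xi)=r_0(\xi)e^{i(k_0\xi+\psi_0(\xi)+\theta)},\qquad B_\theta(\xi)=r_0'(\xi)e^{i(k_0\xi+\psi_0(\xi)+\theta)},$$ $$r_0(\xi)=\sqrt{\frac{2s_0(c)}{-s}}\,\frac1{\cosh(\sqrt{s_0(c)}\,\xi)},\qquad \psi_0(\xi)=p_0(c)\xi-2\frac rs\sqrt{s_0(c)}\tanh\big(\sqrt{s_0(c)}\,\xi\big).$$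 -/

import Mathlib

open Filter Topology
open scoped ContDiff ComplexConjugate

noncomputable section

namespace FPUNormalForm

/-- The determinantal function `Σ(λ; c)` of the linearized travelling wave problem
`c² v''(ξ) = 5 (v(ξ+1) - 2 v(ξ) + v(ξ-1)) - (v(ξ+2) - 2 v(ξ) + v(ξ-2))`:
`v(ξ) = exp (λ ξ)` is a solution iff `Σ(λ; c) = 0`. -/
def dispersion (l : ℂ) (c : ℝ) : ℂ :=
  (c : ℂ) ^ 2 * l ^ 2 - 10 * (Complex.cosh l - 1) + 2 * (Complex.cosh (2 * l) - 1)

/-- `cs` is the critical speed and `k₀` the critical wave number: the neutral (purely imaginary)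
roots of the dispersion relation at speed `cs` are exactly `0` and `± i k₀`, all of them double. -/
structure IsCriticalPair (cs k₀ : ℝ) : Prop where
  one_lt : 1 < cs
  pos : 0 < k₀
  neutral : ∀ k : ℝ, dispersion (Complex.I * k) cs = 0 ↔ k = 0 ∨ k = k₀ ∨ k = -k₀
  double_zero : analyticOrderAt (fun l : ℂ => dispersion l cs) 0 = 2
  double_pos : analyticOrderAt (fun l : ℂ => dispersion l cs) (Complex.I * k₀) = 2
  double_neg : analyticOrderAt (fun l : ℂ => dispersion l cs) (-(Complex.I * k₀)) = 2

/-- `s₀` and `p₀` are the smooth functions on the open neighborhood `V` of `cs`, vanishing at `cs`,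
which describe the unfolding of the double root `i k₀` for `c ∈ V`:
`± √(s₀ c) + i (k₀ + p₀ c)` are roots of `Σ(·; c)`, where both complex square roots `μ` of the
real (possibly negative) number `s₀ c` are meant. -/
structure IsUnfolding (cs k₀ : ℝ) (V : Set ℝ) (p₀ s₀ : ℝ → ℝ) : Prop where
  smooth_p : ContDiffOn ℝ ∞ p₀ V
  smooth_s : ContDiffOn ℝ ∞ s₀ V
  p_crit : p₀ cs = 0
  s_crit : s₀ cs = 0
  root : ∀ c ∈ V, ∀ μ : ℂ, μ ^ 2 = (s₀ c : ℂ) →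
    dispersion (μ + Complex.I * ((k₀ + p₀ c : ℝ) : ℂ)) c = 0

/-- The reversibility symmetry `(A, B) ↦ (Ā, -B̄)`. -/
def reverser (X : ℂ × ℂ) : ℂ × ℂ := (conj X.1, -conj X.2)

/-- The real quantity `i (A B̄ - Ā B)`. -/
def invJ (X : ℂ × ℂ) : ℝ := (Complex.I * (X.1 * conj X.2 - conj X.1 * X.2)).re

/-- A family, parametrized by `(c, D)`, of real affine linear functions of `(I, J)`:
`(I, J) ↦ a₀ (c, D) + a₁ (c, D) I + a₂ (c, D) J`. -/
structure AffineFamily where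
  a₀ : ℝ × ℝ → ℝ
  a₁ : ℝ × ℝ → ℝ
  a₂ : ℝ × ℝ → ℝ

namespace AffineFamily

def eval (P : AffineFamily) (c D I J : ℝ) : ℝ := P.a₀ (c, D) + P.a₁ (c, D) * I + P.a₂ (c, D) * J

/-- The coefficients are `C³` in `(c, D)` on `W`. -/
def IsC3On (P : AffineFamily) (W : Set (ℝ × ℝ)) : Prop :=
  ContDiffOn ℝ 3 P.a₀ W ∧ ContDiffOn ℝ 3 P.a₁ W ∧ ContDiffOn ℝ 3 P.a₂ W

/-- `P_{c,D}(I, J) = q₀(c) + a I + b J + O(|D| + |c - cs| (|I| + |J|))`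
as `(c, D, I, J) → (cs, 0, 0, 0)`. -/
def HasExpansion (P : AffineFamily) (cs : ℝ) (q₀ : ℝ → ℝ) (a b : ℝ) : Prop :=
  (fun x : ℝ × ℝ × ℝ × ℝ =>
      P.eval x.1 x.2.1 x.2.2.1 x.2.2.2 - (q₀ x.1 + a * x.2.2.1 + b * x.2.2.2))
    =O[𝓝 (cs, 0, 0, 0)]
  (fun x : ℝ × ℝ × ℝ × ℝ => |x.2.1| + |x.1 - cs| * (|x.2.2.1| + |x.2.2.2|))

end AffineFamily

/-- The cubic part of the normal form, at the parameter values `(c, D)`. -/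
def cubicField (k₀ : ℝ) (P Q : AffineFamily) (X : ℂ × ℂ) (c D : ℝ) : ℂ × ℂ :=
  (Complex.I * k₀ * X.1 + X.2
      + Complex.I * X.1 * (P.eval c D (‖X.1‖ ^ 2) (invJ X) : ℂ),
   Complex.I * k₀ * X.2
      + Complex.I * X.2 * (P.eval c D (‖X.1‖ ^ 2) (invJ X) : ℂ)
      + X.1 * (Q.eval c D (‖X.1‖ ^ 2) (invJ X) : ℂ))

/-- The full (untruncated) normal form vector field: cubic part plus remainder
`ρ (X, c, D)`, where `X = (A, B)`. -/
def fullField (k₀ : ℝ) (P Q : AffineFamily) (ρ : (ℂ × ℂ) × ℝ × ℝ → ℂ × ℂ)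
    (X : ℂ × ℂ) (c D : ℝ) : ℂ × ℂ :=
  cubicField k₀ P Q X c D + ρ (X, c, D)

/-- The system `X' = fullField k₀ P Q ρ X c D`, posed for `X ∈ U` and parameters
`c ∈ V`, `D ∈ Z`, is a reversible normal form with linear unfolding coefficients `p₀`, `s₀` and
cubic coefficients `r`, `f`, `s`, `g`. -/
structure IsReversibleNormalForm (cs k₀ : ℝ) (p₀ s₀ : ℝ → ℝ) (r f s g : ℝ)
    (U : Set (ℂ × ℂ)) (V Z : Set ℝ) (P Q : AffineFamily)
    (ρ : (ℂ × ℂ) × ℝ × ℝ → ℂ × ℂ) : Prop where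
  coeff_P : P.IsC3On (V ×ˢ Z)
  coeff_Q : Q.IsC3On (V ×ˢ Z)
  expansion_P : P.HasExpansion cs p₀ r f
  expansion_Q : Q.HasExpansion cs s₀ s g
  smooth_rem : ContDiffOn ℝ 6 ρ (U ×ˢ V ×ˢ Z)
  /-- `ρ = O(‖X‖⁴ + ‖X‖ |D| (‖X‖² + |D|²))`. -/
  rem_bound : ρ =O[𝓝 ((0, 0), cs, 0)]
    fun x => ‖x.1‖ ^ 4 + ‖x.1‖ * |x.2.2| * (‖x.1‖ ^ 2 + |x.2.2| ^ 2)
  reversible : ∀ X ∈ U, reverser X ∈ U → ∀ c ∈ V, ∀ D ∈ Z,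
    fullField k₀ P Q ρ (reverser X) c D = -reverser (fullField k₀ P Q ρ X c D)

/-- `X : ℝ → ℂ × ℂ` is a solution on the whole line of the full system, staying in `U`. -/
def IsSolution (k₀ : ℝ) (P Q : AffineFamily) (ρ : (ℂ × ℂ) × ℝ × ℝ → ℂ × ℂ)
    (U : Set (ℂ × ℂ)) (c D : ℝ) (X : ℝ → ℂ × ℂ) : Prop :=
  ∀ ξ : ℝ, X ξ ∈ U ∧ HasDerivAt X (fullField k₀ P Q ρ (X ξ) c D) ξ

/-- A nontrivial curve that is homoclinic to the origin. -/
def IsHomoclinicToZero (X : ℝ → ℂ × ℂ) : Prop :=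
  (∃ ξ, X ξ ≠ 0) ∧ Tendsto X atTop (𝓝 0) ∧ Tendsto X atBot (𝓝 0)

def IsReversible (X : ℝ → ℂ × ℂ) : Prop := ∀ ξ : ℝ, X (-ξ) = reverser (X ξ)

/-- The amplitude `r₀(ξ) = √(2σ/(-s)) / cosh (√σ ξ)`, where `σ = s₀(c)`. -/
def amplitude (σ s : ℝ) (ξ : ℝ) : ℝ :=
  √(2 * σ / (-s)) / Real.cosh (√σ * ξ)

/-- The phase `π₀ ξ - 2 (r/s) √σ tanh (√σ ξ)`, where `σ = s₀(c)` and `π₀ = p₀(c)`. It is the odd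
primitive of `π₀ + r r₀²`. -/
def phase (σ π₀ r s : ℝ) (ξ : ℝ) : ℝ :=
  π₀ * ξ - 2 * (r / s) * √σ * Real.tanh (√σ * ξ)

/-- The explicit homoclinic `(r₀ e^{iφ}, r₀' e^{iφ})`, `φ(ξ) = k₀ ξ + phase ξ + θ`, of the truncated
cubic system with cubic coefficients frozen at `c = cs`. -/
def sechHomoclinic (k₀ σ π₀ r s θ : ℝ) (ξ : ℝ) : ℂ × ℂ :=
  ((amplitude σ s ξ : ℂ) * Complex.exp (Complex.I * ((k₀ * ξ + phase σ π₀ r s ξ + θ : ℝ) : ℂ)),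
   ((deriv (amplitude σ s) ξ : ℝ) : ℂ)
      * Complex.exp (Complex.I * ((k₀ * ξ + phase σ π₀ r s ξ + θ : ℝ) : ℂ)))

end FPUNormalForm

end

/-! Write `ε = √(s₀ c)`. Just above the critical speed `ε²` is comparable to `c - cs`
(`unfolding_bounds`): there the dispersion relation has no nonzero imaginary root, so the unfolded
roots must leave the axis, at a rate read off from the real part of `Σ = 0`.

The substitution `A = ε E α(εξ)`, `B = ε² E β(εξ)`, with `E` the carrier of the explicit wave, turns
the system at `D = 0` into `α' = β`, `β' = α + s|α|²α` plus a perturbation that vanishes at the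
origin and has Lipschitz constant `O(ε)` on bounded sets (`hasDerivAt_modulate`,
`norm_envelopePerturbation_sub_le`). The carrier absorbs `p₀` and the rotation `r r₀²`. The quartic
remainder is just small enough: on a ball of radius `O(ε)` its Lipschitz constant is `O(ε³)`
(`exists_lipschitz_of_quartic`), the scaling contributes one more `ε`, and the second equation is
divided by `ε³`.

The limiting equation has the homoclinic `α = m sech t`, `s m² = -2`. Its linearization splits into
`u'' = (1 - 6 sech²) u` for real parts and `u'' = (1 - 2 sech²) u` for imaginary parts. The decaying
solutions are `sech'` (translation) and `i sech` (rotation); their phase-space values at `0` span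
`iℝ × ℝ`, which is complementary to the fixed space `ℝ × iℝ` of the reverser. Hence every
exponentially decaying forcing on the half line has a decaying response starting in `ℝ × iℝ`, and a
contraction with weight `exp (-t / 2)` gives an envelope within `O(ε)` of the profile
(`exists_halfLine_solution`). Reflection extends it to a reversible solution on the line, for `sin θ
= 0`.

Undoing the scaling, the error is `ε · O(ε) = O(s₀ c) = O(c - cs)`. At `ξ = 0` the explicit waves
have `A = ±ε m`, which dominates this error, so the two solutions are nontrivial and distinct. -/

noncomputable section

namespace FPUNormalForm

open MeasureTheory Set

/-! ### Linear theory on the half line: variation of constants -/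

/-- `φ₁` (decaying) and `φ₂` (growing), with derivatives `χ₁` and `χ₂`, form a fundamental system
of `u'' = q u` with Wronskian one and exponential bounds on the half line `t ≥ 0`. -/
structure IsDichotomy (q φ₁ χ₁ φ₂ χ₂ : ℝ → ℝ) (C : ℝ) : Prop where
  deriv_decaying : ∀ t, HasDerivAt φ₁ (χ₁ t) t
  deriv_decaying' : ∀ t, HasDerivAt χ₁ (q t * φ₁ t) t
  deriv_growing : ∀ t, HasDerivAt φ₂ (χ₂ t) t
  deriv_growing' : ∀ t, HasDerivAt χ₂ (q t * φ₂ t) t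
  wronskian : ∀ t, φ₁ t * χ₂ t - φ₂ t * χ₁ t = 1
  bound_decaying : ∀ t, 0 ≤ t → |φ₁ t| ≤ C * Real.exp (-t)
  bound_decaying' : ∀ t, 0 ≤ t → |χ₁ t| ≤ C * Real.exp (-t)
  bound_growing : ∀ t, 0 ≤ t → |φ₂ t| ≤ C * Real.exp t
  bound_growing' : ∀ t, 0 ≤ t → |χ₂ t| ≤ C * Real.exp t

/-- Coefficient of the decaying solution in the variation of constants formula. -/
def coeffDecaying (φ₂ χ₂ h₁ h₂ : ℝ → ℝ) (t : ℝ) : ℝ :=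
  ∫ τ in (0 : ℝ)..t, (χ₂ τ * h₁ τ - φ₂ τ * h₂ τ)

/-- Coefficient of the growing solution in the variation of constants formula. -/
def coeffGrowing (φ₁ χ₁ h₁ h₂ : ℝ → ℝ) (t : ℝ) : ℝ :=
  ∫ τ in Ioi t, (χ₁ τ * h₁ τ - φ₁ τ * h₂ τ)

/-- Continuous forcing which is exponentially decaying on the half line. -/
def IsForcing {F : Type*} [NormedAddCommGroup F] (h : ℝ → F) : Prop :=
  Continuous h ∧ ∃ M, ∀ t, 0 ≤ t → ‖h t‖ ≤ M * Real.exp (-t / 2)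

lemma IsForcing.sub {F : Type*} [NormedAddCommGroup F] {h k : ℝ → F}
    (hh : IsForcing h) (hk : IsForcing k) : IsForcing (fun t => h t - k t) := by
  obtain ⟨hc, M, hM⟩ := hh
  obtain ⟨kc, N, hN⟩ := hk
  refine ⟨hc.sub kc, M + N, fun t ht => (norm_sub_le _ _).trans ?_⟩
  rw [add_mul]
  exact add_le_add (hM t ht) (hN t ht)

lemma abs_mul_sub_mul_le {a b x y A B : ℝ} (hx : |x| ≤ A) (hy : |y| ≤ A)
    (ha : |a| ≤ B) (hb : |b| ≤ B) : |x * a - y * b| ≤ 2 * (A * B) := by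
  have hA : 0 ≤ A := (abs_nonneg x).trans hx
  calc |x * a - y * b| ≤ |x * a| + |y * b| := abs_sub _ _
    _ = |x| * |a| + |y| * |b| := by rw [abs_mul, abs_mul]
    _ ≤ A * B + A * B := by gcongr
    _ = 2 * (A * B) := by ring

namespace IsDichotomy

variable {q φ₁ χ₁ φ₂ χ₂ : ℝ → ℝ} {C : ℝ} (hd : IsDichotomy q φ₁ χ₁ φ₂ χ₂ C)

include hd

lemma nonneg : 0 ≤ C := by
  have := (abs_nonneg _).trans (hd.bound_decaying 0 le_rfl)
  simpa using this

lemma continuous_decaying : Continuous φ₁ :=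
  continuous_iff_continuousAt.2 fun t => (hd.deriv_decaying t).continuousAt

lemma continuous_decaying' : Continuous χ₁ :=
  continuous_iff_continuousAt.2 fun t => (hd.deriv_decaying' t).continuousAt

lemma continuous_growing : Continuous φ₂ :=
  continuous_iff_continuousAt.2 fun t => (hd.deriv_growing t).continuousAt

lemma continuous_growing' : Continuous χ₂ :=
  continuous_iff_continuousAt.2 fun t => (hd.deriv_growing' t).continuousAt

lemma continuous_integrand_growing {h₁ h₂ : ℝ → ℝ} (hc₁ : Continuous h₁) (hc₂ : Continuous h₂) :
    Continuous fun τ => χ₁ τ * h₁ τ - φ₁ τ * h₂ τ :=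
  (hd.continuous_decaying'.mul hc₁).sub (hd.continuous_decaying.mul hc₂)

lemma continuous_integrand_decaying {h₁ h₂ : ℝ → ℝ} (hc₁ : Continuous h₁) (hc₂ : Continuous h₂) :
    Continuous fun τ => χ₂ τ * h₁ τ - φ₂ τ * h₂ τ :=
  (hd.continuous_growing'.mul hc₁).sub (hd.continuous_growing.mul hc₂)

lemma integrand_growing_le {h₁ h₂ : ℝ → ℝ} {M : ℝ}
    (hM₁ : ∀ t, 0 ≤ t → |h₁ t| ≤ M * Real.exp (-t / 2))
    (hM₂ : ∀ t, 0 ≤ t → |h₂ t| ≤ M * Real.exp (-t / 2)) (t : ℝ) (ht : 0 ≤ t) :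
    |χ₁ t * h₁ t - φ₁ t * h₂ t| ≤ 2 * C * M * Real.exp (-(3 / 2) * t) := by
  refine (abs_mul_sub_mul_le (hd.bound_decaying' t ht) (hd.bound_decaying t ht)
    (hM₁ t ht) (hM₂ t ht)).trans_eq ?_
  rw [show -(3 / 2) * t = -t + -t / 2 by ring, Real.exp_add]
  ring

lemma integrand_decaying_le {h₁ h₂ : ℝ → ℝ} {M : ℝ}
    (hM₁ : ∀ t, 0 ≤ t → |h₁ t| ≤ M * Real.exp (-t / 2))
    (hM₂ : ∀ t, 0 ≤ t → |h₂ t| ≤ M * Real.exp (-t / 2)) (t : ℝ) (ht : 0 ≤ t) :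
    |χ₂ t * h₁ t - φ₂ t * h₂ t| ≤ 2 * C * M * Real.exp (1 / 2 * t) := by
  refine (abs_mul_sub_mul_le (hd.bound_growing' t ht) (hd.bound_growing t ht)
    (hM₁ t ht) (hM₂ t ht)).trans_eq ?_
  rw [show 1 / 2 * t = t + -t / 2 by ring, Real.exp_add]
  ring

lemma integrableOn_growing {h₁ h₂ : ℝ → ℝ} (hf₁ : IsForcing h₁) (hf₂ : IsForcing h₂) (t : ℝ) :
    IntegrableOn (fun τ => χ₁ τ * h₁ τ - φ₁ τ * h₂ τ) (Ioi t) := by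
  have hcont := hd.continuous_integrand_growing hf₁.1 hf₂.1
  obtain ⟨-, M₁, hM₁⟩ := hf₁
  obtain ⟨-, M₂, hM₂⟩ := hf₂
  have hbound := hd.integrand_growing_le (h₁ := h₁) (h₂ := h₂) (M := max M₁ M₂)
    (fun t ht => (hM₁ t ht).trans (by gcongr; exact le_max_left _ _))
    (fun t ht => (hM₂ t ht).trans (by gcongr; exact le_max_right _ _))
  refine integrable_of_isBigO_exp_neg (b := 3 / 2) (by norm_num) hcont.continuousOn ?_
  refine Asymptotics.IsBigO.of_bound (2 * C * max M₁ M₂) ?_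
  filter_upwards [eventually_ge_atTop 0] with τ hτ
  rw [Real.norm_eq_abs, Real.norm_eq_abs, Real.abs_exp]
  exact hbound τ hτ

lemma hasDerivAt_coeffDecaying {h₁ h₂ : ℝ → ℝ} (hf₁ : IsForcing h₁) (hf₂ : IsForcing h₂) (t : ℝ) :
    HasDerivAt (coeffDecaying φ₂ χ₂ h₁ h₂) (χ₂ t * h₁ t - φ₂ t * h₂ t) t := by
  have hcont := hd.continuous_integrand_decaying hf₁.1 hf₂.1
  exact intervalIntegral.integral_hasDerivAt_right (hcont.intervalIntegrable _ _)
    (hcont.stronglyMeasurableAtFilter _ _) hcont.continuousAt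

lemma hasDerivAt_coeffGrowing {h₁ h₂ : ℝ → ℝ} (hf₁ : IsForcing h₁) (hf₂ : IsForcing h₂) (t : ℝ) :
    HasDerivAt (coeffGrowing φ₁ χ₁ h₁ h₂) (-(χ₁ t * h₁ t - φ₁ t * h₂ t)) t := by
  have hcont := hd.continuous_integrand_growing hf₁.1 hf₂.1
  have heq : coeffGrowing φ₁ χ₁ h₁ h₂ = fun t =>
      coeffGrowing φ₁ χ₁ h₁ h₂ 0 - ∫ τ in (0 : ℝ)..t, (χ₁ τ * h₁ τ - φ₁ τ * h₂ τ) := by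
    funext t
    have := intervalIntegral.integral_interval_add_Ioi (hd.integrableOn_growing hf₁ hf₂ 0)
      (hd.integrableOn_growing hf₁ hf₂ t)
    unfold coeffGrowing
    linarith
  rw [heq]
  exact (intervalIntegral.integral_hasDerivAt_right (hcont.intervalIntegrable _ _)
    (hcont.stronglyMeasurableAtFilter _ _) hcont.continuousAt).const_sub _

lemma abs_coeffDecaying_le {h₁ h₂ : ℝ → ℝ} {M : ℝ}
    (hM₁ : ∀ t, 0 ≤ t → |h₁ t| ≤ M * Real.exp (-t / 2))
    (hM₂ : ∀ t, 0 ≤ t → |h₂ t| ≤ M * Real.exp (-t / 2)) (t : ℝ) (ht : 0 ≤ t) :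
    |coeffDecaying φ₂ χ₂ h₁ h₂ t| ≤ 4 * C * M * Real.exp (1 / 2 * t) := by
  have hM : 0 ≤ M := by simpa using (abs_nonneg _).trans (hM₁ 0 le_rfl)
  have hC := hd.nonneg
  have h := intervalIntegral.norm_integral_le_of_norm_le (μ := volume) ht
    (f := fun τ => χ₂ τ * h₁ τ - φ₂ τ * h₂ τ)
    (g := fun τ => 2 * C * M * Real.exp (1 / 2 * τ))
    (Eventually.of_forall fun τ hτ => hd.integrand_decaying_le hM₁ hM₂ τ hτ.1.le)
    ((by fun_prop : Continuous fun τ => 2 * C * M * Real.exp (1 / 2 * τ)).intervalIntegrable _ _)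
  refine h.trans ?_
  rw [intervalIntegral.integral_const_mul,
    intervalIntegral.integral_comp_mul_left (fun x => Real.exp x) (by norm_num), integral_exp,
    mul_zero, Real.exp_zero, smul_eq_mul]
  nlinarith [mul_nonneg hC hM]

lemma abs_coeffGrowing_le {h₁ h₂ : ℝ → ℝ} {M : ℝ}
    (hM₁ : ∀ t, 0 ≤ t → |h₁ t| ≤ M * Real.exp (-t / 2))
    (hM₂ : ∀ t, 0 ≤ t → |h₂ t| ≤ M * Real.exp (-t / 2)) (t : ℝ) (ht : 0 ≤ t) :
    |coeffGrowing φ₁ χ₁ h₁ h₂ t| ≤ 2 * C * M * Real.exp (-(3 / 2) * t) := by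
  have hM : 0 ≤ M := by simpa using (abs_nonneg _).trans (hM₁ 0 le_rfl)
  have hC := hd.nonneg
  have hint : IntegrableOn (fun τ => 2 * C * M * Real.exp (-(3 / 2) * τ)) (Ioi t) :=
    (integrableOn_exp_mul_Ioi (by norm_num) t).const_mul _
  have h := norm_integral_le_of_norm_le (μ := volume.restrict (Ioi t))
    (f := fun τ => χ₁ τ * h₁ τ - φ₁ τ * h₂ τ) hint
    ((ae_restrict_iff' measurableSet_Ioi).2 <| Eventually.of_forall fun τ hτ =>
      hd.integrand_growing_le hM₁ hM₂ τ (ht.trans (le_of_lt hτ)))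
  refine h.trans ?_
  rw [integral_const_mul, integral_exp_mul_Ioi (by norm_num)]
  nlinarith [mul_nonneg (mul_nonneg hC hM) (Real.exp_pos (-(3 / 2) * t)).le]

end IsDichotomy

/-- The solution `u` of `u' = v + h₁`, `v' = q u + h₂` given by variation of constants when
`x₁ = φ₁` and `x₂ = φ₂`; its second component `v` when `x₁ = χ₁` and `x₂ = χ₂`. -/
def variation (φ₁ χ₁ φ₂ χ₂ x₁ x₂ h₁ h₂ : ℝ → ℝ) (t : ℝ) : ℝ :=
  x₁ t * coeffDecaying φ₂ χ₂ h₁ h₂ t + x₂ t * coeffGrowing φ₁ χ₁ h₁ h₂ t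

namespace IsDichotomy

variable {q φ₁ χ₁ φ₂ χ₂ : ℝ → ℝ} {C : ℝ} (hd : IsDichotomy q φ₁ χ₁ φ₂ χ₂ C)

include hd

lemma hasDerivAt_variation_fst {h₁ h₂ : ℝ → ℝ} (hf₁ : IsForcing h₁) (hf₂ : IsForcing h₂) (t : ℝ) :
    HasDerivAt (variation φ₁ χ₁ φ₂ χ₂ φ₁ φ₂ h₁ h₂)
      (variation φ₁ χ₁ φ₂ χ₂ χ₁ χ₂ h₁ h₂ t + h₁ t) t := by
  have h := ((hd.deriv_decaying t).mul (hd.hasDerivAt_coeffDecaying hf₁ hf₂ t)).add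
    ((hd.deriv_growing t).mul (hd.hasDerivAt_coeffGrowing hf₁ hf₂ t))
  refine h.congr_deriv ?_
  unfold variation
  linear_combination (h₁ t) * hd.wronskian t

lemma hasDerivAt_variation_snd {h₁ h₂ : ℝ → ℝ} (hf₁ : IsForcing h₁) (hf₂ : IsForcing h₂) (t : ℝ) :
    HasDerivAt (variation φ₁ χ₁ φ₂ χ₂ χ₁ χ₂ h₁ h₂)
      (q t * variation φ₁ χ₁ φ₂ χ₂ φ₁ φ₂ h₁ h₂ t + h₂ t) t := by
  have h := ((hd.deriv_decaying' t).mul (hd.hasDerivAt_coeffDecaying hf₁ hf₂ t)).add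
    ((hd.deriv_growing' t).mul (hd.hasDerivAt_coeffGrowing hf₁ hf₂ t))
  refine h.congr_deriv ?_
  unfold variation
  linear_combination (h₂ t) * hd.wronskian t

/-- The weight `exp (-t / 2)` decays strictly slower than the homogeneous solution. So the forcing
against the growing solution, integrated from `0`, gives only `exp (t / 2)`, against the decaying
one, integrated from infinity, `exp (-3t / 2)`, and both products return to the same weight. -/
lemma abs_variation_le {x₁ x₂ : ℝ → ℝ} (hx₁ : ∀ t, 0 ≤ t → |x₁ t| ≤ C * Real.exp (-t))
    (hx₂ : ∀ t, 0 ≤ t → |x₂ t| ≤ C * Real.exp t) {h₁ h₂ : ℝ → ℝ} {M : ℝ}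
    (hM₁ : ∀ t, 0 ≤ t → |h₁ t| ≤ M * Real.exp (-t / 2))
    (hM₂ : ∀ t, 0 ≤ t → |h₂ t| ≤ M * Real.exp (-t / 2)) (t : ℝ) (ht : 0 ≤ t) :
    |variation φ₁ χ₁ φ₂ χ₂ x₁ x₂ h₁ h₂ t| ≤ 6 * C ^ 2 * M * Real.exp (-t / 2) := by
  have hC := hd.nonneg
  calc |variation φ₁ χ₁ φ₂ χ₂ x₁ x₂ h₁ h₂ t|
      ≤ |x₁ t| * |coeffDecaying φ₂ χ₂ h₁ h₂ t| + |x₂ t| * |coeffGrowing φ₁ χ₁ h₁ h₂ t| := by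
        rw [← abs_mul, ← abs_mul]
        exact abs_add_le _ _
    _ ≤ C * Real.exp (-t) * (4 * C * M * Real.exp (1 / 2 * t))
        + C * Real.exp t * (2 * C * M * Real.exp (-(3 / 2) * t)) := by
        gcongr
        · exact hx₁ t ht
        · exact hd.abs_coeffDecaying_le hM₁ hM₂ t ht
        · exact hx₂ t ht
        · exact hd.abs_coeffGrowing_le hM₁ hM₂ t ht
    _ = 4 * C ^ 2 * M * (Real.exp (-t) * Real.exp (1 / 2 * t))
        + 2 * C ^ 2 * M * (Real.exp t * Real.exp (-(3 / 2) * t)) := by ring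
    _ = 6 * C ^ 2 * M * Real.exp (-t / 2) := by
        rw [← Real.exp_add, ← Real.exp_add, show -t + 1 / 2 * t = -t / 2 by ring,
          show t + -(3 / 2) * t = -t / 2 by ring]
        ring

lemma variation_sub (x₁ x₂ : ℝ → ℝ) {h₁ h₂ k₁ k₂ : ℝ → ℝ} (hh₁ : IsForcing h₁)
    (hh₂ : IsForcing h₂) (hk₁ : IsForcing k₁) (hk₂ : IsForcing k₂) (t : ℝ) :
    variation φ₁ χ₁ φ₂ χ₂ x₁ x₂ h₁ h₂ t - variation φ₁ χ₁ φ₂ χ₂ x₁ x₂ k₁ k₂ t =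
      variation φ₁ χ₁ φ₂ χ₂ x₁ x₂ (fun t => h₁ t - k₁ t) (fun t => h₂ t - k₂ t) t := by
  have e₁ : coeffDecaying φ₂ χ₂ (fun t => h₁ t - k₁ t) (fun t => h₂ t - k₂ t) t =
      coeffDecaying φ₂ χ₂ h₁ h₂ t - coeffDecaying φ₂ χ₂ k₁ k₂ t := by
    unfold coeffDecaying
    rw [← intervalIntegral.integral_sub
      ((hd.continuous_integrand_decaying hh₁.1 hh₂.1).intervalIntegrable _ _)
      ((hd.continuous_integrand_decaying hk₁.1 hk₂.1).intervalIntegrable _ _)]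
    congr 1 with τ
    ring
  have e₂ : coeffGrowing φ₁ χ₁ (fun t => h₁ t - k₁ t) (fun t => h₂ t - k₂ t) t =
      coeffGrowing φ₁ χ₁ h₁ h₂ t - coeffGrowing φ₁ χ₁ k₁ k₂ t := by
    unfold coeffGrowing
    rw [← integral_sub (hd.integrableOn_growing hh₁ hh₂ t) (hd.integrableOn_growing hk₁ hk₂ t)]
    congr 1 with τ
    ring
  unfold variation
  rw [e₁, e₂]
  ring

end IsDichotomy

/-! ### Explicit fundamental systems for the linearization at the sech profile -/

lemma exp_le_two_mul_cosh (t : ℝ) : Real.exp t ≤ 2 * Real.cosh t := by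
  rw [Real.cosh_eq]
  linarith [Real.exp_pos (-t)]

lemma inv_cosh_le (t : ℝ) : (Real.cosh t)⁻¹ ≤ 2 * Real.exp (-t) := by
  rw [Real.exp_neg, inv_le_iff_one_le_mul₀ (Real.cosh_pos t), mul_assoc, mul_comm, mul_assoc,
    inv_mul_eq_div, one_le_div (Real.exp_pos t), mul_comm] 
  linarith [exp_le_two_mul_cosh t]

lemma inv_cosh_le_one (t : ℝ) : (Real.cosh t)⁻¹ ≤ 1 :=
  inv_le_one_of_one_le₀ (Real.one_le_cosh t)

lemma cosh_le_exp {t : ℝ} (ht : 0 ≤ t) : Real.cosh t ≤ Real.exp t := by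
  rw [Real.cosh_eq]
  linarith [Real.exp_le_exp.2 (show -t ≤ t by linarith)]

lemma abs_sinh_le_cosh (t : ℝ) : |Real.sinh t| ≤ Real.cosh t := by
  rw [abs_le]
  constructor <;> rw [Real.sinh_eq, Real.cosh_eq] <;>
    linarith [Real.exp_pos t, Real.exp_pos (-t)]

lemma hasDerivAt_inv_cosh (t : ℝ) :
    HasDerivAt (fun t => (Real.cosh t)⁻¹) (-(Real.sinh t * (Real.cosh t)⁻¹ ^ 2)) t := by
  refine ((Real.hasDerivAt_cosh t).inv (Real.cosh_pos t).ne').congr_deriv ?_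
  rw [inv_pow]; ring

lemma hasDerivAt_sinh_mul_inv_cosh_sq (t : ℝ) :
    HasDerivAt (fun t => Real.sinh t * (Real.cosh t)⁻¹ ^ 2)
      (2 * (Real.cosh t)⁻¹ ^ 3 - (Real.cosh t)⁻¹) t := by
  refine ((Real.hasDerivAt_sinh t).fun_mul ((hasDerivAt_inv_cosh t).fun_pow 2)).congr_deriv ?_
  have hx : Real.cosh t * (Real.cosh t)⁻¹ = 1 := mul_inv_cancel₀ (Real.cosh_pos t).ne'
  have hs := Real.cosh_sq t
  generalize (Real.cosh t)⁻¹ = x at *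
  simp only [Nat.cast_ofNat, Nat.add_one_sub_one, pow_one]
  linear_combination (2 * x ^ 3) * hs + (-x - 2 * x ^ 2 * Real.cosh t) * hx

lemma hasDerivAt_inv_cosh_cube (t : ℝ) :
    HasDerivAt (fun t => (Real.cosh t)⁻¹ ^ 3)
      (-(3 * (Real.sinh t * (Real.cosh t)⁻¹ ^ 4))) t := by
  refine ((hasDerivAt_inv_cosh t).fun_pow 3).congr_deriv ?_
  simp only [Nat.cast_ofNat, Nat.add_one_sub_one]
  ring

/-- The fundamental system of `u'' = (1 - 2 sech² t) u`. -/
lemma isDichotomy_im : IsDichotomy (fun t => 1 - 2 * (Real.cosh t)⁻¹ ^ 2)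
    (fun t => (Real.cosh t)⁻¹)
    (fun t => -(Real.sinh t * (Real.cosh t)⁻¹ ^ 2))
    (fun t => (Real.sinh t + t * (Real.cosh t)⁻¹) / 2)
    (fun t => (Real.cosh t + ((Real.cosh t)⁻¹ - t * (Real.sinh t * (Real.cosh t)⁻¹ ^ 2))) / 2)
    10 where
  -- The decaying solution is the profile itself, generated by the rotation symmetry. The second
  -- solution is chosen odd, so that its value at `0` vanishes.
  deriv_decaying := hasDerivAt_inv_cosh
  deriv_decaying' t := by
    refine (hasDerivAt_sinh_mul_inv_cosh_sq t).fun_neg.congr_deriv ?_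
    ring
  deriv_growing t := by
    refine (((Real.hasDerivAt_sinh t).add
      ((hasDerivAt_id t).mul (hasDerivAt_inv_cosh t))).div_const 2).congr_deriv ?_
    simp only [id]
    ring
  deriv_growing' t := by
    refine (((Real.hasDerivAt_cosh t).fun_add ((hasDerivAt_inv_cosh t).fun_sub
      ((hasDerivAt_id' t).fun_mul
        (hasDerivAt_sinh_mul_inv_cosh_sq t)))).div_const 2).congr_deriv ?_
    ring
  wronskian t := by
    have hx : Real.cosh t * (Real.cosh t)⁻¹ = 1 := mul_inv_cancel₀ (Real.cosh_pos t).ne'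
    have hs := Real.cosh_sq t
    generalize (Real.cosh t)⁻¹ = x at *
    linear_combination (-x ^ 2 / 2) * hs + (3 / 2 + (Real.cosh t * x - 1) / 2) * hx
  bound_decaying t ht := by
    have h := inv_cosh_le t
    rw [abs_of_pos (inv_pos.2 (Real.cosh_pos t))]
    linarith [Real.exp_pos (-t)]
  bound_decaying' t ht := by
    have h := inv_cosh_le t
    have hc := Real.cosh_pos t
    have : |(-(Real.sinh t * (Real.cosh t)⁻¹ ^ 2))| ≤ (Real.cosh t)⁻¹ := by
      rw [abs_neg, abs_mul, abs_of_pos (by positivity : 0 < (Real.cosh t)⁻¹ ^ 2)]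
      calc _ ≤ Real.cosh t * (Real.cosh t)⁻¹ ^ 2 := by gcongr; exact abs_sinh_le_cosh t
        _ = _ := by field_simp
    linarith [Real.exp_pos (-t)]
  bound_growing t ht := by
    have h := cosh_le_exp ht
    have h1 := abs_sinh_le_cosh t
    have h2 := inv_cosh_le_one t
    have h3 := Real.add_one_le_exp t
    have hc := inv_pos.2 (Real.cosh_pos t)
    have : t * (Real.cosh t)⁻¹ ≤ t := by nlinarith
    have : 0 ≤ t * (Real.cosh t)⁻¹ := by positivity
    rw [abs_le] at h1 ⊢
    constructor <;> linarith [h1.1, h1.2]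
  bound_growing' t ht := by
    have h := cosh_le_exp ht
    have h1 := abs_sinh_le_cosh t
    have h2 := inv_cosh_le_one t
    have h3 := Real.add_one_le_exp t
    have hc := Real.cosh_pos t
    have hc' := inv_pos.2 (Real.cosh_pos t)
    have : |(t * (Real.sinh t * (Real.cosh t)⁻¹ ^ 2))| ≤ t := by
      rw [abs_mul, abs_mul, abs_of_pos (by positivity : 0 < (Real.cosh t)⁻¹ ^ 2), abs_of_nonneg ht]
      calc _ ≤ t * (Real.cosh t * (Real.cosh t)⁻¹ ^ 2) := by gcongr
        _ = t * (Real.cosh t)⁻¹ := by field_simp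
        _ ≤ t := by nlinarith
    rw [abs_le] at this ⊢
    constructor <;> linarith [this.1, this.2]

/-- The fundamental system of `u'' = (1 - 6 sech² t) u`. -/
lemma isDichotomy_re : IsDichotomy (fun t => 1 - 6 * (Real.cosh t)⁻¹ ^ 2)
    (fun t => Real.sinh t * (Real.cosh t)⁻¹ ^ 2)
    (fun t => 2 * (Real.cosh t)⁻¹ ^ 3 - (Real.cosh t)⁻¹)
    (fun t => -(Real.cosh t)⁻¹ + 3 / 2 * (t * (Real.sinh t * (Real.cosh t)⁻¹ ^ 2))
      + (Real.cosh t - (Real.cosh t)⁻¹) / 2)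
    (fun t => 3 * (Real.sinh t * (Real.cosh t)⁻¹ ^ 2)
      + 3 / 2 * (t * (2 * (Real.cosh t)⁻¹ ^ 3 - (Real.cosh t)⁻¹)) + Real.sinh t / 2)
    10 where
  -- The decaying solution is minus the derivative of the profile, generated by translation. The
  -- second solution is chosen even, so that its derivative at `0` vanishes.
  deriv_decaying := hasDerivAt_sinh_mul_inv_cosh_sq
  deriv_decaying' t := by
    refine (((hasDerivAt_inv_cosh_cube t).const_mul 2).fun_sub
      (hasDerivAt_inv_cosh t)).congr_deriv ?_
    ring
  deriv_growing t := by
    refine (((hasDerivAt_inv_cosh t).fun_neg.fun_add (((hasDerivAt_id' t).fun_mul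
      (hasDerivAt_sinh_mul_inv_cosh_sq t)).const_mul (3 / 2))).fun_add
      (((Real.hasDerivAt_cosh t).fun_sub (hasDerivAt_inv_cosh t)).div_const 2)).congr_deriv ?_
    ring
  deriv_growing' t := by
    refine ((((hasDerivAt_sinh_mul_inv_cosh_sq t).const_mul 3).fun_add
      (((hasDerivAt_id' t).fun_mul (((hasDerivAt_inv_cosh_cube t).const_mul 2).fun_sub
      (hasDerivAt_inv_cosh t))).const_mul (3 / 2))).fun_add
      ((Real.hasDerivAt_sinh t).div_const 2)).congr_deriv ?_
    have hx : Real.cosh t * (Real.cosh t)⁻¹ = 1 := mul_inv_cancel₀ (Real.cosh_pos t).ne'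
    generalize (Real.cosh t)⁻¹ = x at *
    linear_combination (3 * x) * hx
  wronskian t := by
    have hc := (Real.cosh_pos t).ne'
    have := Real.cosh_sq t
    field_simp
    linear_combination (-Real.cosh t * (6 + Real.cosh t ^ 2)) * this
  bound_decaying t ht := by
    have h := inv_cosh_le t
    have hc := Real.cosh_pos t
    have : |Real.sinh t * (Real.cosh t)⁻¹ ^ 2| ≤ (Real.cosh t)⁻¹ := by
      rw [abs_mul, abs_of_pos (by positivity : 0 < (Real.cosh t)⁻¹ ^ 2)]
      calc _ ≤ Real.cosh t * (Real.cosh t)⁻¹ ^ 2 := by gcongr; exact abs_sinh_le_cosh t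
        _ = _ := by field_simp
    linarith [Real.exp_pos (-t)]
  bound_decaying' t ht := by
    have h := inv_cosh_le t
    have h2 := inv_cosh_le_one t
    have hc := inv_pos.2 (Real.cosh_pos t)
    have h3 : (Real.cosh t)⁻¹ ^ 3 ≤ (Real.cosh t)⁻¹ := pow_le_of_le_one hc.le h2 (by norm_num)
    have h4 : 0 < (Real.cosh t)⁻¹ ^ 3 := by positivity
    rw [abs_le]
    constructor <;> linarith [Real.exp_pos (-t)]
  bound_growing t ht := by
    have h := cosh_le_exp ht
    have h1 := abs_sinh_le_cosh t
    have h2 := inv_cosh_le_one t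
    have h3 := Real.add_one_le_exp t
    have hc := Real.cosh_pos t
    have hc' := inv_pos.2 (Real.cosh_pos t)
    have : |(t * (Real.sinh t * (Real.cosh t)⁻¹ ^ 2))| ≤ t := by
      rw [abs_mul, abs_mul, abs_of_pos (by positivity : 0 < (Real.cosh t)⁻¹ ^ 2), abs_of_nonneg ht]
      calc _ ≤ t * (Real.cosh t * (Real.cosh t)⁻¹ ^ 2) := by gcongr
        _ = t * (Real.cosh t)⁻¹ := by field_simp
        _ ≤ t := by nlinarith
    rw [abs_le] at this ⊢
    constructor <;> linarith [this.1, this.2]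
  bound_growing' t ht := by
    have h := cosh_le_exp ht
    have h1 := abs_sinh_le_cosh t
    have h2 := inv_cosh_le_one t
    have h3 := Real.add_one_le_exp t
    have hc := Real.cosh_pos t
    have hc' := inv_pos.2 (Real.cosh_pos t)
    have h5 : |Real.sinh t * (Real.cosh t)⁻¹ ^ 2| ≤ (Real.cosh t)⁻¹ := by
      rw [abs_mul, abs_of_pos (by positivity : 0 < (Real.cosh t)⁻¹ ^ 2)]
      calc _ ≤ Real.cosh t * (Real.cosh t)⁻¹ ^ 2 := by gcongr
        _ = _ := by field_simp
    have h6 : (Real.cosh t)⁻¹ ^ 3 ≤ (Real.cosh t)⁻¹ := pow_le_of_le_one hc'.le h2 (by norm_num)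
    have h7 : 0 < (Real.cosh t)⁻¹ ^ 3 := by positivity
    have h8 : |t * (2 * (Real.cosh t)⁻¹ ^ 3 - (Real.cosh t)⁻¹)| ≤ t * 1 := by
      rw [abs_mul, abs_of_nonneg ht]
      gcongr
      rw [abs_le]
      constructor <;> linarith
    rw [abs_le] at h1 h5 h8 ⊢
    constructor <;> linarith [h1.1, h1.2, h5.1, h5.2, h8.1, h8.2]

/-! ### Contraction in an exponentially weighted space -/

open Set Metric

/-- Contraction principle in the space of functions decaying like `exp (-t / 2)` on the half line,
for equations `w = T (H (·, w))` with a bounded solution operator `T`. -/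
lemma exists_weighted_fixedPoint {F : Type*} [NormedAddCommGroup F] [NormedSpace ℝ F]
    [CompleteSpace F] {T : (ℝ → F) → ℝ → F} {C : ℝ} (hC : 0 ≤ C)
    (hTc : ∀ h, IsForcing h → Continuous (T h)) (hT0 : T 0 = 0)
    (hTb : ∀ h k, IsForcing h → IsForcing k → ∀ M,
      (∀ t, 0 ≤ t → ‖h t - k t‖ ≤ M * Real.exp (-t / 2)) →
      ∀ t, 0 ≤ t → ‖T h t - T k t‖ ≤ C * M * Real.exp (-t / 2))
    {H : ℝ → F → F} {δ L m : ℝ} (hδ : 0 < δ)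
    (hHc : ContinuousOn (fun p : ℝ × F => H p.1 p.2) (univ ×ˢ closedBall 0 δ))
    (hHL : ∀ t, 0 ≤ t → ∀ x ∈ closedBall (0 : F) δ, ∀ y ∈ closedBall (0 : F) δ,
      ‖H t x - H t y‖ ≤ L * ‖x - y‖)
    (hH0 : ∀ t, 0 ≤ t → ‖H t 0‖ ≤ m * Real.exp (-t / 2))
    (hL0 : 0 ≤ L) (hm0 : 0 ≤ m) (hL : C * L ≤ 1 / 2) (hm : C * m ≤ δ / 2) :
    ∃ w : ℝ → F, IsForcing (fun t => H t (w t)) ∧ (∀ t, ‖w t‖ ≤ δ) ∧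
      (∀ t, 0 ≤ t → ‖w t‖ ≤ 2 * C * m * Real.exp (-t / 2)) ∧
      ∀ t, 0 ≤ t → w t = T (fun τ => H τ (w τ)) t := by
  classical
  let B : Set (BoundedContinuousFunction ℝ F) := closedBall 0 δ
  -- The unknown is `z = exp (|t| / 2) • w`, so that the weighted norm of `w` becomes a sup norm.
  -- Only `t ≥ 0` matters; the modulus extends the weight evenly, which permits working on the whole
  -- line.
  let W : BoundedContinuousFunction ℝ F → ℝ → F := fun z t => Real.exp (-|t| / 2) • z t
  have hWc : ∀ z, Continuous (W z) := fun z => by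
    have := z.continuous
    fun_prop
  have hWle : ∀ z t, ‖W z t‖ ≤ ‖z‖ * Real.exp (-|t| / 2) := fun z t => by
    rw [norm_smul, Real.norm_eq_abs, Real.abs_exp, mul_comm]
    gcongr
    exact z.norm_coe_le_norm t
  have hexp1 : ∀ t : ℝ, Real.exp (-|t| / 2) ≤ 1 := fun t => by
    rw [Real.exp_le_one_iff]; have := abs_nonneg t; linarith
  have hWδ : ∀ z ∈ B, ∀ t, ‖W z t‖ ≤ δ := fun z hz t => by
    have h1 : ‖z‖ ≤ δ := by simpa [B] using hz
    calc ‖W z t‖ ≤ ‖z‖ * Real.exp (-|t| / 2) := hWle z t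
      _ ≤ δ * 1 := by gcongr; exact hexp1 t
      _ = δ := mul_one δ
  have hWmem : ∀ z ∈ B, ∀ t, W z t ∈ closedBall (0 : F) δ := fun z hz t => by
    simpa using hWδ z hz t
  have hsub : ∀ z ∈ B, ∀ z' ∈ B, ∀ t, 0 ≤ t →
      ‖H t (W z t) - H t (W z' t)‖ ≤ L * ‖z - z'‖ * Real.exp (-t / 2) := by
    intro z hz z' hz' t ht
    refine (hHL t ht _ (hWmem z hz t) _ (hWmem z' hz' t)).trans ?_
    rw [mul_assoc]
    gcongr
    have := hWle (z - z') t
    rw [abs_of_nonneg ht] at this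
    simpa [W, smul_sub, abs_of_nonneg ht] using this
  have hbd : ∀ z ∈ B, ∀ t, 0 ≤ t →
      ‖H t (W z t)‖ ≤ (L * ‖z‖ + m) * Real.exp (-t / 2) := by
    intro z hz t ht
    have h0 : (0 : BoundedContinuousFunction ℝ F) ∈ B := by simp [B, hδ.le]
    have h1 := hsub z hz 0 h0 t ht
    have h2 := hH0 t ht
    have h3 : W 0 t = 0 := by simp [W]
    rw [h3, sub_zero] at h1
    calc ‖H t (W z t)‖ ≤ ‖H t (W z t) - H t 0‖ + ‖H t 0‖ := by
          simpa using norm_add_le (H t (W z t) - H t 0) (H t 0)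
      _ ≤ _ := by rw [add_mul]; exact add_le_add h1 h2
  have hforc : ∀ z ∈ B, IsForcing (fun t => H t (W z t)) := fun z hz =>
    ⟨hHc.comp_continuous (f := fun t => (t, W z t)) (continuous_id.prodMk (hWc z)) (fun t => ⟨mem_univ _, hWmem z hz t⟩),
      _, hbd z hz⟩
  have hzero : IsForcing (0 : ℝ → F) := ⟨continuous_zero, 0, fun t _ => by simp⟩
  have hTle : ∀ z ∈ B, ∀ t, 0 ≤ t → ‖T (fun τ => H τ (W z τ)) t‖
      ≤ C * (L * ‖z‖ + m) * Real.exp (-t / 2) := fun z hz t ht => by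
    have := hTb _ 0 (hforc z hz) hzero (L * ‖z‖ + m)
      (fun t ht => by simpa using hbd z hz t ht) t ht
    simpa [hT0] using this
  have hexpmul : ∀ t : ℝ, Real.exp (|t| / 2) * Real.exp (-|t| / 2) = 1 := fun t => by
    rw [← Real.exp_add, ← Real.exp_zero]; congr 1; ring
  have hΨle : ∀ z ∈ B, ∀ t, ‖Real.exp (|t| / 2) • T (fun τ => H τ (W z τ)) |t|‖
      ≤ C * (L * ‖z‖ + m) := fun z hz t => by
    rw [norm_smul, Real.norm_eq_abs, Real.abs_exp]
    calc _ ≤ Real.exp (|t| / 2) * (C * (L * ‖z‖ + m) * Real.exp (-|t| / 2)) := by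
          gcongr; exact hTle z hz _ (abs_nonneg t)
      _ = C * (L * ‖z‖ + m) * (Real.exp (|t| / 2) * Real.exp (-|t| / 2)) := by ring
      _ = _ := by rw [hexpmul, mul_one]
  have hhalf : ∀ z : BoundedContinuousFunction ℝ F,
      C * (L * ‖z‖ + m) ≤ 1 / 2 * ‖z‖ + C * m := fun z => by
    have := mul_le_mul_of_nonneg_right hL (norm_nonneg z)
    linarith
  -- Evaluation at `|t|` uses the solution operator only on the half line, where its bounds hold.
  let Ψ : B → BoundedContinuousFunction ℝ F := fun z =>
    BoundedContinuousFunction.ofNormedAddCommGroup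
      (fun t => Real.exp (|t| / 2) • T (fun τ => H τ (W z.1 τ)) |t|)
      (by have := hTc _ (hforc z.1 z.2); fun_prop) _ (hΨle z.1 z.2)
  have hΨnorm : ∀ z : B, ‖Ψ z‖ ≤ 1 / 2 * ‖z.1‖ + C * m := fun z =>
    (BoundedContinuousFunction.norm_le (by positivity)).2 fun t =>
      (hΨle z.1 z.2 t).trans (hhalf z.1)
  have hΨB : ∀ z : B, Ψ z ∈ B := fun z => by
    have h1 : ‖z.1‖ ≤ δ := mem_closedBall_zero_iff.1 z.2
    have h2 := hΨnorm z
    simp only [B, mem_closedBall, dist_zero_right]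
    linarith
  let Φ : B → B := fun z => ⟨Ψ z, hΨB z⟩
  have hΦ : ContractingWith (1 / 2) Φ := by
    refine ⟨by rw [← NNReal.coe_lt_coe]; norm_num, LipschitzWith.of_dist_le_mul fun z z' => ?_⟩
    rw [Subtype.dist_eq, Subtype.dist_eq, dist_eq_norm, dist_eq_norm]
    refine (BoundedContinuousFunction.norm_le (by positivity)).2 fun t => ?_
    have h1 := hTb _ _ (hforc z.1 z.2) (hforc z'.1 z'.2) _ (hsub z.1 z.2 z'.1 z'.2)
      |t| (abs_nonneg t)
    have h2 : (Ψ z - Ψ z') t = Real.exp (|t| / 2) • (T (fun τ => H τ (W z.1 τ)) |t|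
        - T (fun τ => H τ (W z'.1 τ)) |t|) := by
      rw [smul_sub]; rfl
    change ‖(Ψ z - Ψ z') t‖ ≤ _
    rw [h2, norm_smul, Real.norm_eq_abs, Real.abs_exp]
    calc _ ≤ Real.exp (|t| / 2) * (C * (L * ‖z.1 - z'.1‖) * Real.exp (-|t| / 2)) := by gcongr
      _ = C * L * ‖z.1 - z'.1‖ * (Real.exp (|t| / 2) * Real.exp (-|t| / 2)) := by ring
      _ = C * L * ‖z.1 - z'.1‖ := by rw [hexpmul, mul_one]
      _ ≤ _ := by gcongr; simpa using hL
  have : Nonempty B := ⟨⟨0, by simp [B, hδ.le]⟩⟩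
  have : CompleteSpace B := (isClosed_closedBall : IsClosed B).completeSpace_coe
  obtain ⟨z, hz⟩ : ∃ z : B, Φ z = z := ⟨_, hΦ.fixedPoint_isFixedPt⟩
  have hz' : Ψ z = z.1 := congrArg Subtype.val hz
  -- A fixed point satisfies `‖z‖ ≤ ‖z‖ / 2 + C m`; absorbing the first term improves the a priori
  -- bound `δ` to one proportional to the forcing `m`.
  have hzn : ‖z.1‖ ≤ 2 * C * m := by
    have := hΨnorm z
    rw [hz'] at this
    linarith
  refine ⟨W z.1, hforc z.1 z.2, hWδ z.1 z.2, fun t ht => ?_, fun t ht => ?_⟩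
  · refine (hWle z.1 t).trans ?_
    rw [abs_of_nonneg ht]
    gcongr
  · have h1 : z.1 t = Real.exp (|t| / 2) • T (fun τ => H τ (W z.1 τ)) |t| := by
      conv_lhs => rw [← hz']
      rfl
    change Real.exp (-|t| / 2) • z.1 t = _
    rw [h1, smul_smul, mul_comm, hexpmul, one_smul, abs_of_nonneg ht]

/-! ### The solution operator of the linearized equation -/

/-- The bounded solution on the half line of the linearization about the sech profile, with forcing
`h`, whose value at `0` lies in `ℝ × iℝ`. -/
def linearSolve (h : ℝ → ℂ × ℂ) (t : ℝ) : ℂ × ℂ :=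
  let re₁ := fun t => (h t).1.re
  let re₂ := fun t => (h t).2.re
  let im₁ := fun t => (h t).1.im
  let im₂ := fun t => (h t).2.im
  let φ₁ : ℝ → ℝ := fun t => Real.sinh t * (Real.cosh t)⁻¹ ^ 2
  let χ₁ : ℝ → ℝ := fun t => 2 * (Real.cosh t)⁻¹ ^ 3 - (Real.cosh t)⁻¹
  let φ₂ : ℝ → ℝ := fun t => -(Real.cosh t)⁻¹ + 3 / 2 * (t * (Real.sinh t * (Real.cosh t)⁻¹ ^ 2))
      + (Real.cosh t - (Real.cosh t)⁻¹) / 2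
  let χ₂ : ℝ → ℝ := fun t => 3 * (Real.sinh t * (Real.cosh t)⁻¹ ^ 2)
      + 3 / 2 * (t * (2 * (Real.cosh t)⁻¹ ^ 3 - (Real.cosh t)⁻¹)) + Real.sinh t / 2
  let ψ₁ : ℝ → ℝ := fun t => (Real.cosh t)⁻¹
  let η₁ : ℝ → ℝ := fun t => -(Real.sinh t * (Real.cosh t)⁻¹ ^ 2)
  let ψ₂ : ℝ → ℝ := fun t => (Real.sinh t + t * (Real.cosh t)⁻¹) / 2
  let η₂ : ℝ → ℝ := fun t =>
    (Real.cosh t + ((Real.cosh t)⁻¹ - t * (Real.sinh t * (Real.cosh t)⁻¹ ^ 2))) / 2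
  ((variation φ₁ χ₁ φ₂ χ₂ φ₁ φ₂ re₁ re₂ t : ℂ) + variation ψ₁ η₁ ψ₂ η₂ ψ₁ ψ₂ im₁ im₂ t * Complex.I,
   (variation φ₁ χ₁ φ₂ χ₂ χ₁ χ₂ re₁ re₂ t : ℂ) + variation ψ₁ η₁ ψ₂ η₂ η₁ η₂ im₁ im₂ t * Complex.I)

lemma norm_ofReal_add_ofReal_mul_I_le {a b A : ℝ} (ha : |a| ≤ A) (hb : |b| ≤ A) :
    ‖(a : ℂ) + b * Complex.I‖ ≤ 2 * A := by
  refine (norm_add_le _ _).trans ?_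
  rw [norm_mul, Complex.norm_I, mul_one, Complex.norm_real, Complex.norm_real]
  simp only [Real.norm_eq_abs]
  linarith

lemma IsForcing.components {h : ℝ → ℂ × ℂ} (hf : IsForcing h) :
    (IsForcing fun t => (h t).1.re) ∧ (IsForcing fun t => (h t).2.re) ∧
      (IsForcing fun t => (h t).1.im) ∧ IsForcing fun t => (h t).2.im := by
  obtain ⟨hc, M, hM⟩ := hf
  refine ⟨⟨by fun_prop, M, fun t ht => (Complex.abs_re_le_norm _).trans ?_⟩,
    ⟨by fun_prop, M, fun t ht => (Complex.abs_re_le_norm _).trans ?_⟩,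
    ⟨by fun_prop, M, fun t ht => (Complex.abs_im_le_norm _).trans ?_⟩,
    ⟨by fun_prop, M, fun t ht => (Complex.abs_im_le_norm _).trans ?_⟩⟩
  · exact (norm_fst_le _).trans (hM t ht)
  · exact (norm_snd_le _).trans (hM t ht)
  · exact (norm_fst_le _).trans (hM t ht)
  · exact (norm_snd_le _).trans (hM t ht)

lemma hasDerivAt_linearSolve {h : ℝ → ℂ × ℂ} (hf : IsForcing h) (t : ℝ) :
    HasDerivAt (linearSolve h)
      ((linearSolve h t).2 + (h t).1,
       (linearSolve h t).1 - 2 * ((Real.cosh t)⁻¹ ^ 2 : ℝ) *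
          (2 * (linearSolve h t).1 + conj (linearSolve h t).1) + (h t).2) t := by
  obtain ⟨f₁, f₂, f₃, f₄⟩ := hf.components
  have d₁ := isDichotomy_re.hasDerivAt_variation_fst f₁ f₂ t
  have d₂ := isDichotomy_re.hasDerivAt_variation_snd f₁ f₂ t
  have d₃ := isDichotomy_im.hasDerivAt_variation_fst f₃ f₄ t
  have d₄ := isDichotomy_im.hasDerivAt_variation_snd f₃ f₄ t
  refine ((d₁.ofReal_comp.add (d₃.ofReal_comp.mul_const Complex.I)).prodMk
    (d₂.ofReal_comp.add (d₄.ofReal_comp.mul_const Complex.I))).congr_deriv ?_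
  simp only [linearSolve]
  refine Prod.ext (Complex.ext ?_ ?_) (Complex.ext ?_ ?_)
  · simp
  · simp
  · simp [-Complex.ofReal_cosh, -Complex.ofReal_pow, -Complex.ofReal_inv]
    ring
  · simp [-Complex.ofReal_cosh, -Complex.ofReal_pow, -Complex.ofReal_inv]
    ring

lemma continuous_linearSolve {h : ℝ → ℂ × ℂ} (hf : IsForcing h) : Continuous (linearSolve h) :=
  continuous_iff_continuousAt.2 fun t => (hasDerivAt_linearSolve hf t).continuousAt

lemma linearSolve_zero : linearSolve 0 = 0 := by
  funext t
  simp [linearSolve, variation, coeffDecaying, coeffGrowing]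

/-- At `0` the integral against the growing solution is empty, so only the growing solution remains;
in the imaginary block it is odd. -/
lemma linearSolve_at_zero_fst_im (h : ℝ → ℂ × ℂ) : (linearSolve h 0).1.im = 0 := by
  simp [linearSolve, variation, coeffDecaying, coeffGrowing]

/-- As for the imaginary part, but in the real block the growing solution is even, so its derivative
vanishes at `0`. -/
lemma linearSolve_at_zero_snd_re (h : ℝ → ℂ × ℂ) : (linearSolve h 0).2.re = 0 := by
  simp [linearSolve, variation, coeffDecaying, coeffGrowing]

lemma norm_linearSolve_sub_le {h k : ℝ → ℂ × ℂ} (hf : IsForcing h) (kf : IsForcing k) (M : ℝ)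
    (hM : ∀ t, 0 ≤ t → ‖h t - k t‖ ≤ M * Real.exp (-t / 2)) (t : ℝ) (ht : 0 ≤ t) :
    ‖linearSolve h t - linearSolve k t‖ ≤ 1200 * M * Real.exp (-t / 2) := by
  obtain ⟨f₁, f₂, f₃, f₄⟩ := hf.components
  obtain ⟨g₁, g₂, g₃, g₄⟩ := kf.components
  have m₁ : ∀ t, 0 ≤ t → |(h t).1.re - (k t).1.re| ≤ M * Real.exp (-t / 2) := fun t ht =>
    ((Complex.abs_re_le_norm ((h t).1 - (k t).1)).trans (norm_fst_le (h t - k t))).trans (hM t ht)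
  have m₂ : ∀ t, 0 ≤ t → |(h t).2.re - (k t).2.re| ≤ M * Real.exp (-t / 2) := fun t ht =>
    ((Complex.abs_re_le_norm ((h t).2 - (k t).2)).trans (norm_snd_le (h t - k t))).trans (hM t ht)
  have m₃ : ∀ t, 0 ≤ t → |(h t).1.im - (k t).1.im| ≤ M * Real.exp (-t / 2) := fun t ht =>
    ((Complex.abs_im_le_norm ((h t).1 - (k t).1)).trans (norm_fst_le (h t - k t))).trans (hM t ht)
  have m₄ : ∀ t, 0 ≤ t → |(h t).2.im - (k t).2.im| ≤ M * Real.exp (-t / 2) := fun t ht =>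
    ((Complex.abs_im_le_norm ((h t).2 - (k t).2)).trans (norm_snd_le (h t - k t))).trans (hM t ht)
  have b₁ := isDichotomy_re.abs_variation_le isDichotomy_re.bound_decaying
    isDichotomy_re.bound_growing m₁ m₂ t ht
  have b₂ := isDichotomy_re.abs_variation_le isDichotomy_re.bound_decaying'
    isDichotomy_re.bound_growing' m₁ m₂ t ht
  have b₃ := isDichotomy_im.abs_variation_le isDichotomy_im.bound_decaying
    isDichotomy_im.bound_growing m₃ m₄ t ht
  have b₄ := isDichotomy_im.abs_variation_le isDichotomy_im.bound_decaying'
    isDichotomy_im.bound_growing' m₃ m₄ t ht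
  rw [← isDichotomy_re.variation_sub _ _ f₁ f₂ g₁ g₂] at b₁ b₂
  rw [← isDichotomy_im.variation_sub _ _ f₃ f₄ g₃ g₄] at b₃ b₄
  -- `1200 = 2 · 6 · 10²`: each real component has the bound `6 C²` with `C = 10`, and the factor
  -- `2` combines real and imaginary parts.
  rw [show 1200 * M * Real.exp (-t / 2) = 2 * (6 * 10 ^ 2 * M * Real.exp (-t / 2)) by ring]
  rw [Prod.norm_def]
  refine max_le ?_ ?_
  · refine le_trans (le_of_eq ?_) (norm_ofReal_add_ofReal_mul_I_le b₁ b₃)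
    congr 1
    simp only [linearSolve, Prod.fst_sub]
    push_cast
    ring
  · refine le_trans (le_of_eq ?_) (norm_ofReal_add_ofReal_mul_I_le b₂ b₄)
    congr 1
    simp only [linearSolve, Prod.snd_sub]
    push_cast
    ring

/-! ### Persistence of the sech profile on the half line -/

/-- The higher order part of `s |α|² α` at the real base point `w`. -/
def cubicTail (s w : ℝ) (a : ℂ) : ℂ :=
  s * (2 * w * (a * conj a) + w * a ^ 2 + a ^ 2 * conj a)

lemma cubic_eq_add_cubicTail (s w : ℝ) (a : ℂ) :
    (s : ℂ) * (((w : ℂ) + a) * conj ((w : ℂ) + a)) * (w + a) =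
      s * w ^ 3 + s * w ^ 2 * (2 * a + conj a) + cubicTail s w a := by
  simp only [cubicTail, map_add, Complex.conj_ofReal]
  ring

/-- Every monomial of the tail is at least quadratic in `a`, so differences gain a factor `δ`; `δ ≤
1` lets the cubic monomial be treated like the quadratic ones. -/
lemma norm_cubicTail_sub_le {s w m δ : ℝ} (hw : |w| ≤ m) (hδ1 : δ ≤ 1) {a b : ℂ}
    (ha : ‖a‖ ≤ δ) (hb : ‖b‖ ≤ δ) :
    ‖cubicTail s w a - cubicTail s w b‖ ≤ |s| * (6 * m + 3) * δ * ‖a - b‖ := by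
  have hδ : 0 ≤ δ := (norm_nonneg a).trans ha
  have hm : 0 ≤ m := (abs_nonneg w).trans hw
  have hd : ‖conj a - conj b‖ = ‖a - b‖ := by rw [← map_sub, RCLike.norm_conj]
  have e : cubicTail s w a - cubicTail s w b =
      s * (2 * w * ((a - b) * conj a + b * (conj a - conj b)) + w * ((a - b) * (a + b))
        + ((a - b) * (a + b) * conj a + b ^ 2 * (conj a - conj b))) := by
    simp only [cubicTail]
    ring
  have hab : ‖a + b‖ ≤ 2 * δ := (norm_add_le _ _).trans (by linarith)
  have hn := norm_nonneg (a - b)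
  have h1 : ‖(a - b) * conj a + b * (conj a - conj b)‖ ≤ 2 * δ * ‖a - b‖ := by
    refine (norm_add_le _ _).trans ?_
    rw [norm_mul, norm_mul, hd, RCLike.norm_conj]
    nlinarith
  have h2 : ‖(a - b) * (a + b)‖ ≤ 2 * δ * ‖a - b‖ := by
    rw [norm_mul]
    nlinarith
  have h3 : ‖(a - b) * (a + b) * conj a + b ^ 2 * (conj a - conj b)‖ ≤ 3 * δ * ‖a - b‖ := by
    refine (norm_add_le _ _).trans ?_
    rw [norm_mul _ (conj a), norm_mul (b ^ 2), hd, RCLike.norm_conj, norm_pow]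
    have h4 : ‖(a - b) * (a + b)‖ * ‖a‖ ≤ 2 * δ * ‖a - b‖ * 1 := by
      gcongr
      linarith
    have h5 : ‖b‖ ^ 2 ≤ δ * 1 := by
      rw [pow_two]
      gcongr
      linarith
    nlinarith
  have hws : ‖(w : ℂ)‖ ≤ m := by simpa using hw
  rw [e, norm_mul, Complex.norm_real, Real.norm_eq_abs,
    show |s| * (6 * m + 3) * δ * ‖a - b‖ = |s| * ((6 * m + 3) * δ * ‖a - b‖) by ring]
  refine mul_le_mul_of_nonneg_left ?_ (abs_nonneg s)
  refine norm_add₃_le.trans ?_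
  rw [norm_mul (2 * (w : ℂ)), norm_mul 2, norm_mul (w : ℂ)]
  have h5 : ‖(w : ℂ)‖ * ‖(a - b) * conj a + b * (conj a - conj b)‖ ≤ m * (2 * δ * ‖a - b‖) := by
    gcongr
  have h6 : ‖(w : ℂ)‖ * ‖(a - b) * (a + b)‖ ≤ m * (2 * δ * ‖a - b‖) := by gcongr
  have h7 : ‖(2 : ℂ)‖ = 2 := by simp
  rw [h7]
  nlinarith

/-- The rescaled sech profile, as a curve in phase space. -/
def profile (m t : ℝ) : ℂ × ℂ :=
  ((m * (Real.cosh t)⁻¹ : ℝ), (-(m * (Real.sinh t * (Real.cosh t)⁻¹ ^ 2)) : ℝ))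

lemma norm_profile_le {m : ℝ} (hm : 0 ≤ m) (t : ℝ) : ‖profile m t‖ ≤ m * (Real.cosh t)⁻¹ := by
  have hc := Real.cosh_pos t
  rw [Prod.norm_def]
  refine max_le ?_ ?_
  · simp only [profile, Complex.norm_real, Real.norm_eq_abs]
    rw [abs_of_nonneg (by positivity)]
  · simp only [profile, Complex.norm_real, Real.norm_eq_abs]
    rw [abs_neg, abs_mul, abs_of_nonneg hm, abs_mul,
      abs_of_pos (by positivity : 0 < (Real.cosh t)⁻¹ ^ 2)]
    gcongr
    calc _ ≤ Real.cosh t * (Real.cosh t)⁻¹ ^ 2 := by gcongr; exact abs_sinh_le_cosh t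
      _ = _ := by field_simp

lemma hasDerivAt_profile {m s : ℝ} (hms : s * m ^ 2 = -2) (t : ℝ) :
    HasDerivAt (profile m) ((profile m t).2, (profile m t).1 + s * (profile m t).1 ^ 3) t := by
  have h1 := ((hasDerivAt_inv_cosh t).const_mul m).ofReal_comp
  have h2 := ((hasDerivAt_sinh_mul_inv_cosh_sq t).const_mul m).fun_neg.ofReal_comp
  refine (h1.prodMk h2).congr_deriv ?_
  simp only [profile]
  ext1
  · push_cast; ring
  · have : (s : ℂ) * m ^ 2 = -2 := by exact_mod_cast congrArg (fun x : ℝ => (x : ℂ)) hms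
    push_cast
    generalize (Complex.cosh t)⁻¹ = x
    linear_combination (-m * x ^ 3) * this

/-- Persistence of the sech profile, on the half line and with initial value in `ℝ × iℝ`, under
small Lipschitz perturbations of the equation `α'' = α + s |α|² α`. -/
theorem exists_halfLine_solution {s m : ℝ} (hm : 0 < m) (hms : s * m ^ 2 = -2) :
    ∃ K > 0, ∃ κ₀ > 0, ∀ (G : ℝ → ℂ × ℂ → ℂ × ℂ) (κ : ℝ), 0 ≤ κ → κ ≤ κ₀ →
      ContinuousOn (fun p : ℝ × (ℂ × ℂ) => G p.1 p.2) (univ ×ˢ closedBall 0 (m + 1)) →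
      (∀ t, G t 0 = 0) →
      (∀ t, ∀ X ∈ closedBall (0 : ℂ × ℂ) (m + 1), ∀ Y ∈ closedBall (0 : ℂ × ℂ) (m + 1),
        ‖G t X - G t Y‖ ≤ κ * ‖X - Y‖) →
      ∃ X : ℝ → ℂ × ℂ,
        (∀ t, 0 ≤ t → HasDerivAt X
          (((X t).2, (X t).1 + s * ((X t).1 * conj (X t).1) * (X t).1) + G t (X t)) t) ∧
        (X 0).1.im = 0 ∧ (X 0).2.re = 0 ∧
        (∀ t, 0 ≤ t → ‖X t - profile m t‖ ≤ K * κ * Real.exp (-t / 2)) ∧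
        ∀ t, 0 ≤ t → X t ∈ closedBall (0 : ℂ × ℂ) (m + 1) := by
  have hs : s ≠ 0 := by rintro rfl; norm_num at hms
  set N : ℝ := |s| * (6 * m + 3) with hN
  have hN0 : 0 < N := by positivity
  -- `4800 = 4 · 1200`, where `1200` bounds the linear solution operator: with `N δ` and `κ` both at
  -- most `1 / 4800`, the contraction factor `1200 (N δ + κ)` is at most `1 / 2`.
  set δ : ℝ := min 1 (1 / (4800 * N)) with hδdef
  have hδ : 0 < δ := by positivity
  have hδ1 : δ ≤ 1 := min_le_left _ _
  have hδN : N * δ ≤ 1 / 4800 := by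
    calc N * δ ≤ N * (1 / (4800 * N)) := by gcongr; exact min_le_right _ _
      _ = 1 / 4800 := by field_simp
  -- The residual of the profile is at most `2 m κ exp (-t / 2)`, and the fixed point costs `2 ·
  -- 1200`. The cap `δ / (4800 m)` keeps the correction inside the ball of radius `δ`.
  refine ⟨2 * 1200 * (2 * m), by positivity, min (1 / 4800) (δ / (4800 * m)), by positivity, ?_⟩
  intro G κ hκ hκ₀ hGc hG0 hGL
  have hκ1 : κ ≤ 1 / 4800 := hκ₀.trans (min_le_left _ _)
  have hκ2 : 1200 * (κ * (2 * m)) ≤ δ / 2 := by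
    have : κ ≤ δ / (4800 * m) := hκ₀.trans (min_le_right _ _)
    rw [le_div_iff₀ (by positivity)] at this
    linarith
  have hprof : ∀ t, ‖profile m t‖ ≤ m := fun t => (norm_profile_le hm.le t).trans <| by
    have := inv_cosh_le_one t
    nlinarith
  have hball : ∀ t, ∀ x ∈ closedBall (0 : ℂ × ℂ) δ,
      profile m t + x ∈ closedBall (0 : ℂ × ℂ) (m + 1) := fun t x hx => by
    rw [mem_closedBall, dist_zero_right] at hx ⊢
    exact (norm_add_le _ _).trans (add_le_add (hprof t) (hx.trans hδ1))
  have hpc : Continuous (profile m) :=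
    continuous_iff_continuousAt.2 fun t => (hasDerivAt_profile hms t).continuousAt
  let H : ℝ → ℂ × ℂ → ℂ × ℂ := fun t x =>
    ((0 : ℂ), cubicTail s (m * (Real.cosh t)⁻¹) x.1) + G t (profile m t + x)
  have hHc : ContinuousOn (fun p : ℝ × (ℂ × ℂ) => H p.1 p.2) (univ ×ˢ closedBall 0 δ) := by
    refine ContinuousOn.add ?_ ?_
    · have hc : Continuous fun t : ℝ => (m * (Real.cosh t)⁻¹ : ℝ) :=
        continuous_const.mul (Real.continuous_cosh.inv₀ fun t => (Real.cosh_pos t).ne')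
      have hct : Continuous fun q : ℝ × ℂ => cubicTail s q.1 q.2 := by
        unfold cubicTail
        fun_prop
      exact (continuous_const.prodMk (hct.comp ((hc.comp continuous_fst).prodMk
        (continuous_fst.comp continuous_snd)))).continuousOn
    · exact hGc.comp (f := fun p : ℝ × (ℂ × ℂ) => (p.1, profile m p.1 + p.2))
        (by fun_prop : Continuous _).continuousOn
        (fun p hp => ⟨mem_univ _, hball _ _ hp.2⟩)
  have hHL : ∀ t, 0 ≤ t → ∀ x ∈ closedBall (0 : ℂ × ℂ) δ, ∀ y ∈ closedBall (0 : ℂ × ℂ) δ,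
      ‖H t x - H t y‖ ≤ (N * δ + κ) * ‖x - y‖ := by
    intro t _ x hx y hy
    have h1 := hGL t _ (hball t x hx) _ (hball t y hy)
    rw [add_sub_add_left_eq_sub] at h1
    rw [mem_closedBall, dist_zero_right] at hx hy
    have h2 : |m * (Real.cosh t)⁻¹| ≤ m := by
      rw [abs_of_nonneg (mul_nonneg hm.le (inv_nonneg.2 (Real.cosh_pos t).le))]
      have := inv_cosh_le_one t
      nlinarith
    have h3 := norm_cubicTail_sub_le (s := s) h2 hδ1 ((norm_fst_le x).trans hx)
      ((norm_fst_le y).trans hy)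
    have h4 : ‖x.1 - y.1‖ ≤ ‖x - y‖ := norm_fst_le (x - y)
    have e : H t x - H t y = ((0 : ℂ), cubicTail s (m * (Real.cosh t)⁻¹) x.1
        - cubicTail s (m * (Real.cosh t)⁻¹) y.1)
        + (G t (profile m t + x) - G t (profile m t + y)) := by
      simp only [H]
      rw [add_sub_add_comm, Prod.mk_sub_mk, sub_zero]
    rw [e, add_mul]
    refine (norm_add_le _ _).trans (add_le_add ?_ h1)
    rw [Prod.norm_def, norm_zero, max_eq_right (norm_nonneg _)]
    refine h3.trans ?_
    gcongr
  have hH0 : ∀ t, 0 ≤ t → ‖H t 0‖ ≤ κ * (2 * m) * Real.exp (-t / 2) := by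
    intro t ht
    have h1 := hGL t (profile m t) (by simpa using hball t 0 (by simp [hδ.le])) 0
      (by simp; positivity)
    rw [hG0, sub_zero, sub_zero] at h1
    have e : H t 0 = G t (profile m t) := by simp [H, cubicTail]
    rw [e]
    refine h1.trans ?_
    rw [mul_assoc]
    gcongr
    refine (norm_profile_le hm.le t).trans ?_
    have h2 := inv_cosh_le t
    have h3 : Real.exp (-t) ≤ Real.exp (-t / 2) := Real.exp_le_exp.2 (by linarith)
    nlinarith
  obtain ⟨w, hwf, hwδ, hwe, hw⟩ := exists_weighted_fixedPoint (C := 1200) (by norm_num)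
    (fun h hf => continuous_linearSolve hf) linearSolve_zero
    (fun h k hf kf M hM t ht => norm_linearSolve_sub_le hf kf M hM t ht)
    hδ hHc hHL hH0 (by positivity) (by positivity) (by linarith) hκ2
  set h : ℝ → ℂ × ℂ := fun t => H t (w t) with hh
  -- The correction is `linearSolve h` rather than `w`: they agree only for `t ≥ 0`, but the former
  -- is differentiable on the whole line, which yields the two-sided derivative at `0`.
  refine ⟨fun t => profile m t + linearSolve h t, fun t ht => ?_, ?_, ?_, fun t ht => ?_,
    fun t ht => ?_⟩
  · refine ((hasDerivAt_profile hms t).fun_add (hasDerivAt_linearSolve hwf t)).congr_deriv ?_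
    have e1 : h t = ((0 : ℂ), cubicTail s (m * (Real.cosh t)⁻¹) (linearSolve h t).1)
        + G t (profile m t + linearSolve h t) := by
      rw [← hw t ht]
    have e2 := cubic_eq_add_cubicTail s (m * (Real.cosh t)⁻¹) (linearSolve h t).1
    have e3 : (profile m t).1 = ((m * (Real.cosh t)⁻¹ : ℝ) : ℂ) := rfl
    have e4 : (s : ℂ) * ((m * (Real.cosh t)⁻¹ : ℝ) : ℂ) ^ 2 =
        -2 * (((Real.cosh t)⁻¹ ^ 2 : ℝ) : ℂ) := by
      have : (s : ℂ) * m ^ 2 = -2 := by exact_mod_cast congrArg (fun x : ℝ => (x : ℂ)) hms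
      push_cast
      linear_combination ((Complex.cosh t)⁻¹ ^ 2) * this
    rw [e4] at e2
    have e5 : (h t).1 = (G t (profile m t + linearSolve h t)).1 := by rw [e1]; simp
    have e6 : (h t).2 = cubicTail s (m * (Real.cosh t)⁻¹) (linearSolve h t).1 +
        (G t (profile m t + linearSolve h t)).2 := by rw [e1]; simp
    ext1
    · simp only [Prod.fst_add, Prod.snd_add, e5]
      ring
    · simp only [Prod.fst_add, Prod.snd_add, e6, e3]
      rw [e2]
      ring
  · simp [profile, linearSolve_at_zero_fst_im]
  · simp [profile, linearSolve_at_zero_snd_re]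
  · have := hwe t ht
    rw [hw t ht] at this
    calc _ = ‖linearSolve h t‖ := by simp
      _ ≤ _ := this
      _ = _ := by ring
  · have := hball t (w t) (by simpa using hwδ t)
    rwa [hw t ht] at this

/-! ### The dispersion relation just above the critical speed -/

/-- The dispersion relation on the imaginary axis. -/
def neutralDispersion (k c : ℝ) : ℝ :=
  -c ^ 2 * k ^ 2 + 2 * (1 - Real.cos k) + 4 * (1 - Real.cos k) ^ 2

lemma dispersion_re (x k c : ℝ) :
    (dispersion ((x : ℂ) + Complex.I * k) c).re = neutralDispersion k c + c ^ 2 * x ^ 2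
      - 10 * (Real.cosh x - 1) * Real.cos k
      + 2 * (Real.cosh (2 * x) - 1) * Real.cos (2 * k) := by
  have h1 : Complex.cosh ((x : ℂ) + Complex.I * k) =
      (Real.cosh x * Real.cos k : ℝ) + (Real.sinh x * Real.sin k : ℝ) * Complex.I := by
    rw [mul_comm, Complex.cosh_add, Complex.cosh_mul_I, Complex.sinh_mul_I]
    push_cast
    ring
  have h2 : Complex.cosh (2 * ((x : ℂ) + Complex.I * k)) =
      (Real.cosh (2 * x) * Real.cos (2 * k) : ℝ)
        + (Real.sinh (2 * x) * Real.sin (2 * k) : ℝ) * Complex.I := by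
    rw [show 2 * ((x : ℂ) + Complex.I * k) = (2 * x : ℂ) + (2 * k : ℂ) * Complex.I by ring,
      Complex.cosh_add, Complex.cosh_mul_I, Complex.sinh_mul_I]
    push_cast
    ring
  have h3 : (c : ℂ) ^ 2 * ((x : ℂ) + Complex.I * k) ^ 2 =
      (c ^ 2 * (x ^ 2 - k ^ 2) : ℝ) + (2 * c ^ 2 * x * k : ℝ) * Complex.I := by
    push_cast
    linear_combination ((c : ℂ) ^ 2 * k ^ 2) * Complex.I_sq
  unfold dispersion
  rw [h1, h2, h3]
  simp only [Complex.sub_re, Complex.add_re, Complex.ofReal_re, Complex.mul_re, Complex.I_re,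
    Complex.I_im, Complex.ofReal_im, Complex.one_re, Complex.re_ofNat, Complex.im_ofNat,
    Complex.sub_im, Complex.add_im, Complex.mul_im, Complex.one_im, neutralDispersion]
  linear_combination (2 : ℝ) * Real.cos_two_mul k

lemma dispersion_I_mul (k c : ℝ) :
    dispersion (Complex.I * k) c = (neutralDispersion k c : ℂ) := by
  unfold dispersion neutralDispersion
  rw [mul_comm Complex.I, show 2 * ((k : ℂ) * Complex.I) = (2 * k : ℂ) * Complex.I by ring,
    Complex.cosh_mul_I, Complex.cosh_mul_I, Complex.cos_two_mul]
  push_cast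
  linear_combination ((c : ℂ) ^ 2 * k ^ 2) * Complex.I_sq

lemma continuous_neutralDispersion (c : ℝ) : Continuous fun k => neutralDispersion k c := by
  unfold neutralDispersion
  fun_prop

namespace IsCriticalPair

variable {cs k₀ : ℝ} (hcrit : IsCriticalPair cs k₀)

include hcrit

lemma neutralDispersion_eq_zero {k : ℝ} (hk : 0 < k) (h : neutralDispersion k cs = 0) :
    k = k₀ := by
  have := (hcrit.neutral k).1 (by rw [dispersion_I_mul, h, Complex.ofReal_zero])
  rcases this with h | h | h
  · exact absurd h hk.ne'
  · exact h
  · linarith [hcrit.pos]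

/-- The function is negative near `0` because `cs > 1`, and negative for large `k`. Its only
positive zero is `k₀`, so a positive value on either side of `k₀` would force another zero by the
intermediate value theorem. -/
lemma neutralDispersion_nonpos {k : ℝ} (hk : 0 < k) : neutralDispersion k cs ≤ 0 := by
  by_contra! hpos
  have h1 := hcrit.one_lt
  have hcont := continuous_neutralDispersion cs
  have hcos := Real.neg_one_le_cos
  rcases lt_or_ge k k₀ with hlt | hge
  · obtain ⟨a, ha0, hak, ha⟩ : ∃ a, 0 < a ∧ a ≤ k ∧ neutralDispersion a cs < 0 := by
      -- From `1 - cos a ≤ a² / 2` the value at `a` is at most `-a² (cs² - 1 - a²)`, which is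
      -- negative once `a² ≤ b²`.
      set b := √((cs ^ 2 - 1) / 2) with hb
      have hb2 : b ^ 2 = (cs ^ 2 - 1) / 2 := Real.sq_sqrt (by nlinarith)
      have hb0 : 0 < b := Real.sqrt_pos.2 (by nlinarith)
      refine ⟨min k b, lt_min hk hb0, min_le_left _ _, ?_⟩
      have ha0 : 0 < min k b := lt_min hk hb0
      have hab : min k b ^ 2 ≤ b ^ 2 := by gcongr; exact min_le_right _ _
      generalize min k b = a at *
      have hy := Real.one_sub_sq_div_two_le_cos (x := a)
      have hy1 := Real.cos_le_one a
      have hy2 : (1 - Real.cos a) ^ 2 ≤ (a ^ 2 / 2) ^ 2 := by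
        gcongr
        · linarith
      have ha2 : 0 < a ^ 2 := by positivity
      unfold neutralDispersion
      nlinarith
    obtain ⟨x, hx, hx0⟩ := intermediate_value_Icc hak hcont.continuousOn ⟨ha.le, hpos.le⟩
    have := hcrit.neutralDispersion_eq_zero (ha0.trans_le hx.1) hx0
    linarith [hx.2]
  -- The trigonometric terms are at most `2 · 2 + 4 · 2² = 20`, less than `5²`.
  · have hbig : neutralDispersion (k + 5) cs < 0 := by
      have h2 : 1 - Real.cos (k + 5) ≤ 2 := by linarith [hcos (k + 5)]
      have h3 : 0 ≤ 1 - Real.cos (k + 5) := by linarith [Real.cos_le_one (k + 5)]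
      have h4 : (5 : ℝ) ^ 2 ≤ (k + 5) ^ 2 := by gcongr; linarith
      have h5 : (1 : ℝ) ^ 2 ≤ cs ^ 2 := by gcongr
      unfold neutralDispersion
      nlinarith
    obtain ⟨x, hx, hx0⟩ := intermediate_value_Icc' (by linarith : k ≤ k + 5) hcont.continuousOn
      ⟨hbig.le, hpos.le⟩
    have h2 := hcrit.neutralDispersion_eq_zero (hk.trans_le hx.1) hx0
    have h3 : k = k₀ := le_antisymm (hx.1.trans h2.le) hge
    have h4 := (hcrit.neutral k).2 (Or.inr (Or.inl h3))
    rw [dispersion_I_mul] at h4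
    exact hpos.ne' (by exact_mod_cast h4)

lemma neutralDispersion_le {c k : ℝ} (hk : 0 < k) :
    neutralDispersion k c ≤ -((c ^ 2 - cs ^ 2) * k ^ 2) := by
  have := hcrit.neutralDispersion_nonpos hk
  unfold neutralDispersion at *
  linarith

/-- Beyond the critical speed the double roots unfold off the imaginary axis, with a real part whose
square is comparable to `c - cs`. -/
lemma unfolding_bounds {V : Set ℝ} (hV : IsOpen V) (hVc : cs ∈ V) {p₀ s₀ : ℝ → ℝ}
    (hunf : IsUnfolding cs k₀ V p₀ s₀) :
    ∃ κ > 0, ∃ L > 0, ∀ᶠ c in 𝓝[>] cs, c ∈ V ∧ κ * (c - cs) ≤ s₀ c ∧ s₀ c ≤ L * (c - cs) := by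
  have hk₀ := hcrit.pos
  have hcs := hcrit.one_lt
  have hVn : V ∈ 𝓝 cs := hV.mem_nhds hVc
  have hdiff : DifferentiableAt ℝ s₀ cs :=
    (hunf.smooth_s.contDiffAt hVn).differentiableAt (by simp)
  obtain ⟨L, hL0, hL⟩ := hdiff.isBigO_sub.exists_pos
  have hpc : Tendsto p₀ (𝓝 cs) (𝓝 0) := by
    have := (hunf.smooth_p.contDiffAt hVn).continuousAt
    rwa [ContinuousAt, hunf.p_crit] at this
  have hsc : Tendsto s₀ (𝓝 cs) (𝓝 0) := by
    have := hdiff.continuousAt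
    rwa [ContinuousAt, hunf.s_crit] at this
  -- The constant is the quotient of `2 (k₀ / 2)²`, from `c² - cs² ≥ 2 (c - cs)` and `k₀ + p₀ c ≥ k₀
  -- / 2`, by a bound for `c² + 10 + 2 · 4`.
  refine ⟨k₀ ^ 2 / 2 / ((cs + 1) ^ 2 + 18), by positivity, L, hL0, ?_⟩
  have hev : ∀ᶠ c in 𝓝 cs, c ∈ V ∧ ‖s₀ c - s₀ cs‖ ≤ L * ‖c - cs‖ ∧ -(k₀ / 2) < p₀ c ∧
      s₀ c < 1 / 2 ∧ c < cs + 1 := by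
    filter_upwards [hVn, hL.bound, hpc.eventually (lt_mem_nhds (by linarith : -(k₀ / 2) < 0)),
      hsc.eventually (gt_mem_nhds (by norm_num : (0 : ℝ) < 1 / 2)), gt_mem_nhds (lt_add_one cs)]
      with c h1 h2 h3 h4 h5 using ⟨h1, h2, h3, h4, h5⟩
  filter_upwards [hev.filter_mono nhdsWithin_le_nhds, self_mem_nhdsWithin]
    with c ⟨hcV, hcL, hp, hs, hc1⟩ hc
  have hc : cs < c := hc
  have hK : k₀ / 2 ≤ k₀ + p₀ c := by linarith
  have hK0 : 0 < k₀ + p₀ c := by linarith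
  have hsq : 0 < c ^ 2 - cs ^ 2 := by nlinarith
  -- Were `s₀ c ≤ 0`, the root would be purely imaginary and nonzero, which `neutralDispersion_le`
  -- excludes for `c > cs`.
  have hpos : 0 < s₀ c := by
    by_contra! hneg
    have h1 := hunf.root c hcV (Complex.I * (√(-s₀ c) : ℝ)) (by
      rw [mul_pow, Complex.I_sq, ← Complex.ofReal_pow, Real.sq_sqrt (by linarith)]
      push_cast
      ring)
    rw [← mul_add, ← Complex.ofReal_add, dispersion_I_mul] at h1
    have hk1 : 0 < √(-s₀ c) + (k₀ + p₀ c) := by positivity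
    have h2 := hcrit.neutralDispersion_le (c := c) hk1
    have h3 : neutralDispersion (√(-s₀ c) + (k₀ + p₀ c)) c = 0 := by exact_mod_cast h1
    have : 0 < (c ^ 2 - cs ^ 2) * (√(-s₀ c) + (k₀ + p₀ c)) ^ 2 := by positivity
    linarith
  refine ⟨hcV, ?_, ?_⟩
  · have h1 := hunf.root c hcV (√(s₀ c) : ℝ) (by
      rw [← Complex.ofReal_pow, Real.sq_sqrt hpos.le])
    have h2 := congrArg Complex.re h1
    rw [dispersion_re, Real.sq_sqrt hpos.le, Complex.zero_re] at h2
    have h3 := hcrit.neutralDispersion_le (c := c) hK0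
    -- `cosh x ≤ exp (x² / 2)` combined with `|exp y - 1| ≤ 2 |y|` for `|y| ≤ 1`; the same argument
    -- at `2 √(s₀ c)` is what requires `s₀ c < 1 / 2`.
    have hch1 : Real.cosh √(s₀ c) - 1 ≤ s₀ c := by
      have h4 := Real.cosh_le_exp_half_sq √(s₀ c)
      rw [Real.sq_sqrt hpos.le] at h4
      have h5 := (abs_le.1 (Real.abs_exp_sub_one_le (x := s₀ c / 2)
        (by rw [abs_of_pos (by positivity)]; linarith))).2
      rw [abs_of_pos (by positivity)] at h5
      linarith
    have hch2 : Real.cosh (2 * √(s₀ c)) - 1 ≤ 4 * s₀ c := by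
      have h4 := Real.cosh_le_exp_half_sq (2 * √(s₀ c))
      rw [mul_pow, Real.sq_sqrt hpos.le] at h4
      have h5 := (abs_le.1 (Real.abs_exp_sub_one_le (x := 2 ^ 2 * s₀ c / 2)
        (by rw [abs_of_pos (by positivity)]; linarith))).2
      rw [abs_of_pos (by positivity)] at h5
      linarith
    have hch3 := Real.one_le_cosh √(s₀ c)
    have hch4 := Real.one_le_cosh (2 * √(s₀ c))
    have hb1 : -((Real.cosh √(s₀ c) - 1) * Real.cos (k₀ + p₀ c)) ≤ s₀ c := by
      have := Real.neg_one_le_cos (k₀ + p₀ c)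
      nlinarith
    have hb2 : (Real.cosh (2 * √(s₀ c)) - 1) * Real.cos (2 * (k₀ + p₀ c)) ≤ 4 * s₀ c := by
      have := Real.cos_le_one (2 * (k₀ + p₀ c))
      nlinarith
    have h6 : (c ^ 2 - cs ^ 2) * (k₀ + p₀ c) ^ 2 ≤ (c ^ 2 + 18) * s₀ c := by linarith
    have h7 : 2 * (c - cs) * (k₀ / 2) ^ 2 ≤ (c ^ 2 - cs ^ 2) * (k₀ + p₀ c) ^ 2 := by
      gcongr
      nlinarith
    have h8 : (c ^ 2 + 18) * s₀ c ≤ ((cs + 1) ^ 2 + 18) * s₀ c := by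
      gcongr
      linarith
    rw [div_mul_eq_mul_div, div_le_iff₀ (by positivity)]
    linarith
  · rw [hunf.s_crit, sub_zero, Real.norm_eq_abs, Real.norm_eq_abs,
      abs_of_pos (by linarith : 0 < c - cs)] at hcL
    exact (le_abs_self _).trans hcL

end IsCriticalPair

/-! ### Lipschitz bound for the quartic remainder -/

/-- A derivative is controlled by the function and its fourth derivative. -/
lemma norm_derivWithin_le_of_fourth {F : Type*} [NormedAddCommGroup F] [NormedSpace ℝ F]
    {φ : ℝ → F} (hφ : ContDiffOn ℝ 4 φ (Icc 0 3)) {M C : ℝ} (hM : ∀ x ∈ Icc (0 : ℝ) 3, ‖φ x‖ ≤ M)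
    (hC : ∀ x ∈ Icc (0 : ℝ) 3, ‖iteratedDerivWithin 4 φ (Icc 0 3) x‖ ≤ C) :
    ‖derivWithin φ (Icc 0 3) 0‖ ≤ 7 * M + 70 * C := by
  have hC0 : 0 ≤ C := (norm_nonneg _).trans (hC 0 (by simp))
  have hR : ∀ x ∈ Icc (0 : ℝ) 3,
      ‖φ x - taylorWithinEval φ 3 (Icc 0 3) 0 x‖ ≤ 14 * C := by
    intro x hx
    refine (taylor_mean_remainder_bound (n := 3) (by norm_num) (by exact_mod_cast hφ) hx
      hC).trans ?_
    have : x ^ 4 ≤ 3 ^ 4 := pow_le_pow_left₀ hx.1 hx.2 4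
    have h2 : (Nat.factorial 3 : ℝ) = 6 := by norm_num [Nat.factorial]
    rw [sub_zero, h2]
    nlinarith
  -- The four-point forward difference for the derivative at `0` is exact on cubics, so only the
  -- Taylor remainders at `1`, `2`, `3` enter as errors.
  have e : derivWithin φ (Icc 0 3) 0 = (3 : ℝ) • φ 1 - (3 / 2 : ℝ) • φ 2 + (1 / 3 : ℝ) • φ 3
      - (11 / 6 : ℝ) • φ 0 - (3 : ℝ) • (φ 1 - taylorWithinEval φ 3 (Icc 0 3) 0 1)
      + (3 / 2 : ℝ) • (φ 2 - taylorWithinEval φ 3 (Icc 0 3) 0 2)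
      - (1 / 3 : ℝ) • (φ 3 - taylorWithinEval φ 3 (Icc 0 3) 0 3) := by
    simp only [taylorWithinEval_succ, taylor_within_zero_eval]
    norm_num [Nat.factorial]
    module
  have m0 := hM 0 (by norm_num)
  have m1 := hM 1 (by norm_num)
  have m2 := hM 2 (by norm_num)
  have m3 := hM 3 (by norm_num)
  have r1 := hR 1 (by norm_num)
  have r2 := hR 2 (by norm_num)
  have r3 := hR 3 (by norm_num)
  have hM0 := (norm_nonneg _).trans m0
  have hs : ∀ (a : ℝ) (x : F), 0 ≤ a → ‖a • x‖ = a * ‖x‖ := fun a x ha => by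
    rw [norm_smul, Real.norm_eq_abs, abs_of_nonneg ha]
  rw [e]
  calc _ ≤ ‖(3 : ℝ) • φ 1‖ + ‖(3 / 2 : ℝ) • φ 2‖ + ‖(1 / 3 : ℝ) • φ 3‖
      + ‖(11 / 6 : ℝ) • φ 0‖ + ‖(3 : ℝ) • (φ 1 - taylorWithinEval φ 3 (Icc 0 3) 0 1)‖
      + ‖(3 / 2 : ℝ) • (φ 2 - taylorWithinEval φ 3 (Icc 0 3) 0 2)‖
      + ‖(1 / 3 : ℝ) • (φ 3 - taylorWithinEval φ 3 (Icc 0 3) 0 3)‖ := by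
        refine (norm_sub_le _ _).trans (add_le_add_left ?_ _)
        refine (norm_add_le _ _).trans (add_le_add_left ?_ _)
        refine (norm_sub_le _ _).trans (add_le_add_left ?_ _)
        refine (norm_sub_le _ _).trans (add_le_add_left ?_ _)
        refine (norm_add_le _ _).trans (add_le_add_left ?_ _)
        exact norm_sub_le _ _
    _ ≤ _ := by
        rw [hs _ _ (by norm_num), hs _ _ (by norm_num), hs _ _ (by norm_num), hs _ _ (by norm_num),
          hs _ _ (by norm_num), hs _ _ (by norm_num), hs _ _ (by norm_num)]
        linarith

/-- The line is affine, so derivatives of order at least two vanish. The form `‖h‖ ^ i` is the one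
needed for the bound on derivatives of a composition. -/
lemma norm_iteratedFDerivWithin_line_le {E : Type*} [NormedAddCommGroup E] [NormedSpace ℝ E]
    (p h : E) {i : ℕ} (hi : 1 ≤ i) {x : ℝ} (hx : x ∈ Icc (0 : ℝ) 3) :
    ‖iteratedFDerivWithin ℝ i (fun t : ℝ => p + t • h) (Icc 0 3) x‖ ≤ ‖h‖ ^ i := by
  have hc : ContDiff ℝ i (fun t : ℝ => p + t • h) := by fun_prop
  rw [norm_iteratedFDerivWithin_eq_norm_iteratedDerivWithin,
    iteratedDerivWithin_eq_iteratedDeriv (uniqueDiffOn_Icc (by norm_num)) hc.contDiffAt hx]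
  have hd : deriv (fun t : ℝ => p + t • h) = fun _ => h := by
    funext t
    simpa using (((hasDerivAt_id t).smul_const h).const_add p).deriv
  obtain _ | _ | i := i
  · omega
  · simp [iteratedDeriv_succ', hd]
  · rw [iteratedDeriv_succ', hd, iteratedDeriv_succ']
    simp only [deriv_const']
    rw [iteratedDeriv_const]
    split_ifs <;> simp

/-- A `C⁴` family of maps which is `O(‖X‖⁴)` has Lipschitz constant `O(r³)` on the ball of
radius `r`. -/
lemma exists_lipschitz_of_quartic {E F : Type*} [NormedAddCommGroup E] [NormedSpace ℝ E]
    [NormedAddCommGroup F] [NormedSpace ℝ F]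
    {ρ : E × ℝ × ℝ → F} {W : Set (E × ℝ × ℝ)} {c₀ : ℝ} (hW : IsOpen W) (hmem : ((0 : E), c₀, (0 : ℝ)) ∈ W)
    (hρ : ContDiffOn ℝ 4 ρ W) {B : ℝ}
    (hB : ∀ᶠ x in 𝓝 ((0 : E), c₀, (0 : ℝ)), x.2.2 = 0 → ‖ρ x‖ ≤ B * ‖x.1‖ ^ 4) :
    ∃ K > 0, ∃ R > 0, ∀ c, |c - c₀| < R → ∀ r, 0 < r → r ≤ R →
      ∀ X ∈ closedBall (0 : E) r, ∀ Y ∈ closedBall (0 : E) r,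
        ‖ρ (X, c, 0) - ρ (Y, c, 0)‖ ≤ K * r ^ 3 * ‖X - Y‖ := by
  classical
  obtain ⟨C, hC0, hC⟩ : ∃ C, 0 ≤ C ∧ ∀ᶠ x in 𝓝 ((0 : E), c₀, (0 : ℝ)), ∀ i ≤ 4,
      ‖iteratedFDerivWithin ℝ i ρ W x‖ ≤ C := by
    refine ⟨∑ i ∈ Finset.range 5, (‖iteratedFDerivWithin ℝ i ρ W (0, c₀, 0)‖ + 1),
      Finset.sum_nonneg fun i _ => by positivity, ?_⟩
    have h1 : ∀ i ∈ Finset.range 5, ∀ᶠ x in 𝓝 ((0 : E), c₀, (0 : ℝ)),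
        ‖iteratedFDerivWithin ℝ i ρ W x‖ < ‖iteratedFDerivWithin ℝ i ρ W (0, c₀, 0)‖ + 1 := by
      intro i hi
      have hcont := (hρ.continuousOn_iteratedFDerivWithin (m := i)
        (by exact_mod_cast Nat.lt_succ_iff.1 (Finset.mem_range.1 hi))
        hW.uniqueDiffOn).continuousAt (hW.mem_nhds hmem)
      exact hcont.norm.eventually (gt_mem_nhds (lt_add_one _))
    filter_upwards [(Filter.eventually_all_finset _).2 h1] with x hx i hi
    have hi' : i ∈ Finset.range 5 := Finset.mem_range.2 (by omega)
    exact (hx i hi').le.trans (Finset.single_le_sum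
      (f := fun i => ‖iteratedFDerivWithin ℝ i ρ W (0, c₀, 0)‖ + 1)
      (fun i _ => by positivity) hi')
  have hWe : ∀ᶠ x in 𝓝 ((0 : E), c₀, (0 : ℝ)), x ∈ W := hW.mem_nhds hmem
  obtain ⟨ε, hε, hball⟩ := Metric.eventually_nhds_iff_ball.1 (hWe.and (hC.and hB))
  have hnear : ∀ c, |c - c₀| < ε / 5 → ∀ X : E, ‖X‖ ≤ 4 * (ε / 5) →
      ((X, c, 0) : E × ℝ × ℝ) ∈ ball ((0 : E), c₀, (0 : ℝ)) ε := by
    intro c hc X hX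
    rw [mem_ball, Prod.dist_eq, Prod.dist_eq, max_lt_iff, max_lt_iff, dist_zero_right,
      Real.dist_eq, dist_self]
    exact ⟨by linarith, by linarith, hε⟩
  refine ⟨7 * |B| * 256 + 70 * (24 * C) + 1, by positivity, ε / 5, by positivity, ?_⟩
  intro c hc r hr hrR X hX Y hY
  have hdiff : ∀ Z ∈ closedBall (0 : E) r, DifferentiableAt ℝ (fun Z => ρ (Z, c, 0)) Z := by
    intro Z hZ
    rw [mem_closedBall, dist_zero_right] at hZ
    have hZW := (hball _ (hnear c hc Z (by linarith))).1
    exact ((hρ.contDiffAt (hW.mem_nhds hZW)).differentiableAt (by norm_num)).comp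
      (f := fun Z : E => (Z, c, (0 : ℝ))) Z (by fun_prop)
  -- Directions of length exactly `r` balance the two terms: along the segment of length `3 r` the
  -- values are at most `|B| (4 r)⁴` and the fourth derivative at most `4! C r⁴`. Dividing by `r`
  -- afterwards gives the operator norm `O(r³)`.
  have hdir : ∀ Z ∈ closedBall (0 : E) r, ∀ h : E, ‖h‖ = r →
      ‖fderiv ℝ (fun Z => ρ (Z, c, 0)) Z h‖ ≤ (7 * |B| * 256 + 70 * (24 * C)) * r ^ 4 := by
    intro Z hZ h hh
    have hd := hdiff Z hZ
    rw [mem_closedBall, dist_zero_right] at hZ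
    set f : ℝ → E × ℝ × ℝ := fun t => (Z, c, 0) + t • (h, 0, 0) with hf
    have hf' : ∀ t, f t = (Z + t • h, c, 0) := fun t => by simp [hf]
    have hhn : ‖((h, 0, 0) : E × ℝ × ℝ)‖ = r := by simp [Prod.norm_def, hh, hr.le]
    have hfn : ∀ t ∈ Icc (0 : ℝ) 3, ‖Z + t • h‖ ≤ 4 * r := by
      intro t ht
      refine (norm_add_le _ _).trans ?_
      rw [norm_smul, hh, Real.norm_eq_abs, abs_of_nonneg ht.1]
      nlinarith [ht.2]
    have hfb : ∀ t ∈ Icc (0 : ℝ) 3, f t ∈ ball ((0 : E), c₀, (0 : ℝ)) ε := by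
      intro t ht
      rw [hf']
      exact hnear c hc _ ((hfn t ht).trans (by linarith))
    have hfc : ContDiff ℝ 4 f := by fun_prop
    have hmaps : MapsTo f (Icc 0 3) W := fun t ht => (hball _ (hfb t ht)).1
    have hu : UniqueDiffOn ℝ (Icc (0 : ℝ) 3) := uniqueDiffOn_Icc (by norm_num)
    have key := norm_derivWithin_le_of_fourth (φ := ρ ∘ f) (hρ.comp hfc.contDiffOn hmaps)
      (M := |B| * (4 * r) ^ 4) (C := 24 * C * r ^ 4) (fun t ht => ?_) (fun t ht => ?_)
    · have e : derivWithin (ρ ∘ f) (Icc 0 3) 0 = fderiv ℝ (fun Z => ρ (Z, c, 0)) Z h := by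
        refine HasDerivWithinAt.derivWithin ?_ (hu 0 (by simp))
        have e1 : ρ ∘ f = (fun Z => ρ (Z, c, 0)) ∘ fun t : ℝ => Z + t • h := by
          funext t
          simp [hf']
        rw [e1]
        have hl : HasDerivAt (fun t : ℝ => Z + t • h) h 0 := by
          simpa using ((hasDerivAt_id (0 : ℝ)).smul_const h).const_add Z
        have hd' : HasFDerivAt (fun Z => ρ (Z, c, 0)) (fderiv ℝ (fun Z => ρ (Z, c, 0)) Z)
            (Z + (0 : ℝ) • h) := by simpa using hd.hasFDerivAt
        exact (hd'.comp_hasDerivAt 0 hl).hasDerivWithinAt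
      rw [e] at key
      refine key.trans_eq ?_
      ring
    · have h1 := (hball _ (hfb t ht)).2.2
      rw [hf'] at h1
      have h2 := h1 rfl
      simp only [Function.comp_apply, hf']
      refine h2.trans ?_
      gcongr
      · exact le_abs_self B
      · exact hfn t ht
    · rw [← norm_iteratedFDerivWithin_eq_norm_iteratedDerivWithin, ← hhn]
      exact norm_iteratedFDerivWithin_comp_le hρ hfc.contDiffOn (by norm_num) hW.uniqueDiffOn hu
        hmaps ht (fun i hi => (hball _ (hfb t ht)).2.1 i hi)
        (fun i hi _ => norm_iteratedFDerivWithin_line_le _ _ hi ht)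
  have hop : ∀ Z ∈ closedBall (0 : E) r, ‖fderiv ℝ (fun Z => ρ (Z, c, 0)) Z‖ ≤
      (7 * |B| * 256 + 70 * (24 * C) + 1) * r ^ 3 := by
    intro Z hZ
    refine ContinuousLinearMap.opNorm_le_bound _ (by positivity) fun h => ?_
    rcases eq_or_ne h 0 with rfl | hh
    · simp
    have hn : 0 < ‖h‖ := norm_pos_iff.2 hh
    have h1 := hdir Z hZ ((r / ‖h‖) • h) (by
      rw [norm_smul, Real.norm_eq_abs, abs_of_pos (by positivity)]
      field_simp)
    rw [map_smul, norm_smul, Real.norm_eq_abs, abs_of_pos (by positivity), div_mul_eq_mul_div,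
      div_le_iff₀ hn] at h1
    have h2 : r * ‖fderiv ℝ (fun Z => ρ (Z, c, 0)) Z h‖ ≤
        r * ((7 * |B| * 256 + 70 * (24 * C) + 1) * r ^ 3 * ‖h‖) := by
      have : 0 ≤ r ^ 4 * ‖h‖ := by positivity
      linarith
    exact le_of_mul_le_mul_left h2 hr
  exact (convex_closedBall (0 : E) r).norm_image_sub_le_of_norm_fderiv_le hdiff hop hY hX

/-! ### Coefficients and the cubic part of the perturbation -/

/-- Coefficients of an affine family with the given expansion, at `D = 0`. -/
lemma AffineFamily.HasExpansion.coefficients {P : AffineFamily} {cs : ℝ} {q₀ : ℝ → ℝ} {a b : ℝ}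
    (h : P.HasExpansion cs q₀ a b) :
    ∃ K > 0, ∀ᶠ c in 𝓝 cs, P.a₀ (c, 0) = q₀ c ∧ |P.a₁ (c, 0) - a| ≤ K * |c - cs| ∧
      |P.a₂ (c, 0) - b| ≤ K * |c - cs| := by
  obtain ⟨K, hK, hb⟩ := Asymptotics.IsBigO.exists_pos h
  obtain ⟨δ, hδ, hball⟩ := Metric.eventually_nhds_iff_ball.1 hb.bound
  refine ⟨K, hK, ?_⟩
  filter_upwards [Metric.ball_mem_nhds cs hδ] with c hc
  have hmem : ∀ I J : ℝ, |I| < δ → |J| < δ →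
      (c, (0 : ℝ), I, J) ∈ ball (cs, (0 : ℝ), (0 : ℝ), (0 : ℝ)) δ := by
    intro I J hI hJ
    rw [mem_ball] at hc ⊢
    simp only [Prod.dist_eq, max_lt_iff, dist_self, Real.dist_eq, sub_zero]
    exact ⟨hc, hδ, hI, hJ⟩
  -- At `D = I = J = 0` the error term is zero, so the constant coefficient is exactly `q₀ c`.
  -- Setting only one of `I`, `J` to `δ / 2` then isolates each remaining coefficient.
  have h0 := hball _ (hmem 0 0 (by simpa) (by simpa))
  have hd : |δ / 2| < δ := by rw [abs_of_pos (by positivity)]; linarith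
  have h1 := hball _ (hmem (δ / 2) 0 hd (by simpa))
  have h2 := hball _ (hmem 0 (δ / 2) (by simpa) hd)
  simp only [AffineFamily.eval, mul_zero, add_zero, abs_zero, norm_zero, norm_le_zero_iff,
    sub_eq_zero] at h0
  have hpos : 0 < δ / 2 := by positivity
  refine ⟨h0, ?_, ?_⟩
  · simp only [AffineFamily.eval, mul_zero, add_zero, zero_add, abs_zero, h0, Real.norm_eq_abs,
      add_sub_add_left_eq_sub, ← sub_mul, abs_mul, abs_abs, abs_of_pos hpos, ← mul_assoc] at h1
    exact le_of_mul_le_mul_right h1 hpos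
  · simp only [AffineFamily.eval, mul_zero, add_zero, zero_add, abs_zero, h0, Real.norm_eq_abs,
      add_sub_add_left_eq_sub, ← sub_mul, abs_mul, abs_abs, abs_of_pos hpos, ← mul_assoc] at h2
    exact le_of_mul_le_mul_right h2 hpos

/-- The cubic perturbation, with coefficients `u`. -/
def cubicPerturbation (u : Fin 5 → ℝ) (X : ℂ × ℂ) : ℂ × ℂ :=
  (Complex.I * X.1 * ((u 0 * ‖X.1‖ ^ 2 + u 1 * invJ X - u 2 : ℝ) : ℂ),
   Complex.I * X.2 * ((u 0 * ‖X.1‖ ^ 2 + u 1 * invJ X - u 2 : ℝ) : ℂ)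
    + X.1 * ((u 3 * ‖X.1‖ ^ 2 + u 4 * invJ X : ℝ) : ℂ))

lemma contDiff_cubicPerturbation :
    ContDiff ℝ 1 fun p : (Fin 5 → ℝ) × (ℂ × ℂ) => cubicPerturbation p.1 p.2 := by
  have hconj : ContDiff ℝ 1 (fun z : ℂ => conj z) := Complex.conjCLE.contDiff
  have hre : ContDiff ℝ 1 Complex.re := Complex.reCLM.contDiff
  have hofReal : ContDiff ℝ 1 (fun x : ℝ => (x : ℂ)) := Complex.ofRealCLM.contDiff
  have hu : ∀ i, ContDiff ℝ 1 fun p : (Fin 5 → ℝ) × (ℂ × ℂ) => p.1 i := fun i =>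
    (contDiff_apply ℝ ℝ i).comp contDiff_fst
  have hA : ContDiff ℝ 1 fun p : (Fin 5 → ℝ) × (ℂ × ℂ) => p.2.1 := contDiff_fst.comp contDiff_snd
  have hB : ContDiff ℝ 1 fun p : (Fin 5 → ℝ) × (ℂ × ℂ) => p.2.2 := contDiff_snd.comp contDiff_snd
  have hn : ContDiff ℝ 1 fun p : (Fin 5 → ℝ) × (ℂ × ℂ) => ‖p.2.1‖ ^ 2 := hA.norm_sq ℝ
  have hJ : ContDiff ℝ 1 fun p : (Fin 5 → ℝ) × (ℂ × ℂ) => invJ p.2 :=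
    hre.comp (contDiff_const.mul ((hA.mul (hconj.comp hB)).sub ((hconj.comp hA).mul hB)))
  have h1 := hofReal.comp ((((hu 0).mul hn).add ((hu 1).mul hJ)).sub (hu 2))
  have h2 := hofReal.comp (((hu 3).mul hn).add ((hu 4).mul hJ))
  exact ((contDiff_const.mul hA).mul h1).prodMk (((contDiff_const.mul hB).mul h1).add (hA.mul h2))

/-- The coefficients are treated as variables of a jointly `C¹` map on a compact set, so that the
constant is uniform in time and in `c`. -/
lemma exists_lipschitz_cubicPerturbation (L R : ℝ) :
    ∃ K > 0, ∀ u : Fin 5 → ℝ, ‖u‖ ≤ L → ∀ X ∈ closedBall (0 : ℂ × ℂ) R,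
      ∀ Y ∈ closedBall (0 : ℂ × ℂ) R,
        ‖cubicPerturbation u X - cubicPerturbation u Y‖ ≤ K * ‖X - Y‖ := by
  obtain ⟨K, hK⟩ := LocallyLipschitzOn.exists_lipschitzOnWith_of_compact
    ((isCompact_closedBall (0 : Fin 5 → ℝ) L).prod (isCompact_closedBall (0 : ℂ × ℂ) R))
    (contDiff_cubicPerturbation.locallyLipschitz.locallyLipschitzOn)
  refine ⟨K + 1, by positivity, fun u hu X hX Y hY => ?_⟩
  have hu' : u ∈ closedBall (0 : Fin 5 → ℝ) L := by simpa using hu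
  have := hK.dist_le_mul (u, X) ⟨hu', hX⟩ (u, Y) ⟨hu', hY⟩
  rw [dist_prod_same_left, dist_eq_norm, dist_eq_norm] at this
  refine this.trans ?_
  gcongr
  linarith

/-! ### Modulation and the envelope equation -/

/-- The slowly modulated wave with carrier `E` and rescaled envelope `X`. -/
def modulate (ε : ℝ) (E : ℝ → ℂ) (X : ℝ → ℂ × ℂ) (ξ : ℝ) : ℂ × ℂ :=
  (ε * (E ξ * (X (ε * ξ)).1), ε ^ 2 * (E ξ * (X (ε * ξ)).2))

/-- The perturbation of the equation for the envelope in rescaled time, where `g` is the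
remainder of the normal form. -/
def envelopePerturbation (ε : ℝ) (E : ℝ → ℂ) (u : ℝ → Fin 5 → ℝ) (g : ℂ × ℂ → ℂ × ℂ) (t : ℝ)
    (X : ℂ × ℂ) : ℂ × ℂ :=
  (ε : ℂ) • cubicPerturbation (u t) X +
    ((E (t / ε))⁻¹ * ((ε : ℂ) ^ 2)⁻¹ *
        (g (ε * (E (t / ε) * X.1), ε ^ 2 * (E (t / ε) * X.2))).1,
     (E (t / ε))⁻¹ * ((ε : ℂ) ^ 3)⁻¹ *
        (g (ε * (E (t / ε) * X.1), ε ^ 2 * (E (t / ε) * X.2))).2)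

lemma norm_scaled_le {ε : ℝ} (hε : 0 < ε) (hε1 : ε ≤ 1) {z : ℂ} (hz : ‖z‖ = 1) (X : ℂ × ℂ) :
    ‖((ε * (z * X.1), ε ^ 2 * (z * X.2)) : ℂ × ℂ)‖ ≤ ε * ‖X‖ := by
  rw [Prod.norm_def]
  refine max_le ?_ ?_
  · rw [norm_mul, norm_mul, hz, one_mul, Complex.norm_real, Real.norm_eq_abs, abs_of_pos hε]
    gcongr
    exact norm_fst_le X
  · rw [norm_mul, norm_mul, hz, one_mul, norm_pow, Complex.norm_real, Real.norm_eq_abs,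
      abs_of_pos hε]
    calc ε ^ 2 * ‖X.2‖ ≤ ε * ‖X‖ := by
          gcongr
          · exact pow_le_of_le_one hε.le hε1 (by norm_num)
          · exact norm_snd_le X

/-- The cubic part carries an explicit `ε`. For the remainder, `(ε R)³` times the factor `ε` from
the scaling gives `ε⁴`; division by `ε²` or `ε³` leaves at least one power of `ε`. -/
lemma norm_envelopePerturbation_sub_le {ε : ℝ} (hε : 0 < ε) (hε1 : ε ≤ 1) {E : ℝ → ℂ}
    (hE : ∀ ξ, ‖E ξ‖ = 1) {u : ℝ → Fin 5 → ℝ} {g : ℂ × ℂ → ℂ × ℂ} {R K M : ℝ} (hM : 0 ≤ M)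
    (hR : 0 ≤ R) {t : ℝ} {X Y : ℂ × ℂ} (hX : X ∈ closedBall (0 : ℂ × ℂ) R)
    (hY : Y ∈ closedBall (0 : ℂ × ℂ) R)
    (hu : ‖cubicPerturbation (u t) X - cubicPerturbation (u t) Y‖ ≤ K * ‖X - Y‖)
    (hg : ∀ X ∈ closedBall (0 : ℂ × ℂ) (ε * R), ∀ Y ∈ closedBall (0 : ℂ × ℂ) (ε * R),
      ‖g X - g Y‖ ≤ M * (ε * R) ^ 3 * ‖X - Y‖) :
    ‖envelopePerturbation ε E u g t X - envelopePerturbation ε E u g t Y‖ ≤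
      (K + M * R ^ 3) * ε * ‖X - Y‖ := by
  rw [mem_closedBall, dist_zero_right] at hX hY
  set z := E (t / ε) with hz
  have hz1 : ‖z‖ = 1 := hE _
  let S : ℂ × ℂ → ℂ × ℂ := fun X => (ε * (z * X.1), ε ^ 2 * (z * X.2))
  have hS : ∀ X, ‖X‖ ≤ R → S X ∈ closedBall (0 : ℂ × ℂ) (ε * R) := fun X hX => by
    rw [mem_closedBall, dist_zero_right]
    exact (norm_scaled_le hε hε1 hz1 X).trans (by gcongr)
  have hSS : ‖S X - S Y‖ ≤ ε * ‖X - Y‖ := by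
    have e : S X - S Y = S (X - Y) := by
      simp only [S, Prod.mk_sub_mk, Prod.fst_sub, Prod.snd_sub]
      ext1 <;> ring
    rw [e]
    exact norm_scaled_le hε hε1 hz1 _
  have hgS : ‖g (S X) - g (S Y)‖ ≤ M * R ^ 3 * ε ^ 4 * ‖X - Y‖ := by
    calc _ ≤ M * (ε * R) ^ 3 * ‖S X - S Y‖ := hg _ (hS X hX) _ (hS Y hY)
      _ ≤ M * (ε * R) ^ 3 * (ε * ‖X - Y‖) := by gcongr
      _ = _ := by ring
  have e : envelopePerturbation ε E u g t X - envelopePerturbation ε E u g t Y =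
      (ε : ℂ) • (cubicPerturbation (u t) X - cubicPerturbation (u t) Y) +
        (z⁻¹ * ((ε : ℂ) ^ 2)⁻¹ * (g (S X) - g (S Y)).1,
         z⁻¹ * ((ε : ℂ) ^ 3)⁻¹ * (g (S X) - g (S Y)).2) := by
    simp only [envelopePerturbation, S, ← hz, smul_sub]
    rw [add_sub_add_comm, Prod.fst_sub, Prod.snd_sub, mul_sub, mul_sub]
    rfl
  rw [e, add_mul, add_mul]
  refine (norm_add_le _ _).trans (add_le_add ?_ ?_)
  · rw [norm_smul, Complex.norm_real, Real.norm_eq_abs, abs_of_pos hε]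
    calc _ ≤ ε * (K * ‖X - Y‖) := by gcongr
      _ = _ := by ring
  · have h1 : ‖(g (S X) - g (S Y)).1‖ ≤ M * R ^ 3 * ε ^ 4 * ‖X - Y‖ := (norm_fst_le _).trans hgS
    have h2 : ‖(g (S X) - g (S Y)).2‖ ≤ M * R ^ 3 * ε ^ 4 * ‖X - Y‖ := (norm_snd_le _).trans hgS
    have hq : ∀ n : ℕ, ‖z⁻¹ * ((ε : ℂ) ^ n)⁻¹‖ = (ε ^ n)⁻¹ := fun n => by
      rw [norm_mul, norm_inv, norm_inv, hz1, norm_pow, Complex.norm_real, Real.norm_eq_abs,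
        abs_of_pos hε, inv_one, one_mul]
    rw [Prod.norm_def]
    refine max_le ?_ ?_
    · rw [norm_mul, hq, inv_mul_le_iff₀ (by positivity)]
      refine h1.trans ?_
      calc M * R ^ 3 * ε ^ 4 * ‖X - Y‖ = M * R ^ 3 * ‖X - Y‖ * ε ^ 4 := by ring
        _ ≤ M * R ^ 3 * ‖X - Y‖ * ε ^ 3 := by
            gcongr _ * ?_
            exact pow_le_pow_of_le_one hε.le hε1 (by norm_num)
        _ = _ := by ring
    · rw [norm_mul, hq, inv_mul_le_iff₀ (by positivity)]
      refine h2.trans_eq ?_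
      ring

lemma continuousOn_envelopePerturbation {ε : ℝ} (hε : 0 < ε) (hε1 : ε ≤ 1) {E : ℝ → ℂ}
    (hE : ∀ ξ, ‖E ξ‖ = 1) (hEc : Continuous E) {u : ℝ → Fin 5 → ℝ} (hu : Continuous u)
    {g : ℂ × ℂ → ℂ × ℂ} {R : ℝ} (hg : ContinuousOn g (closedBall 0 (ε * R))) :
    ContinuousOn (fun p : ℝ × (ℂ × ℂ) => envelopePerturbation ε E u g p.1 p.2)
      (univ ×ˢ closedBall 0 R) := by
  have hE' : Continuous fun p : ℝ × (ℂ × ℂ) => E (p.1 / ε) := by fun_prop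
  have hinv : Continuous fun p : ℝ × (ℂ × ℂ) => (E (p.1 / ε))⁻¹ := hE'.inv₀ fun p h => by
    simpa [h] using hE (p.1 / ε)
  have hS : ContinuousOn (fun p : ℝ × (ℂ × ℂ) =>
      g (ε * (E (p.1 / ε) * p.2.1), ε ^ 2 * (E (p.1 / ε) * p.2.2))) (univ ×ˢ closedBall 0 R) := by
    refine hg.comp (f := fun p : ℝ × (ℂ × ℂ) =>
      ((ε * (E (p.1 / ε) * p.2.1), ε ^ 2 * (E (p.1 / ε) * p.2.2)) : ℂ × ℂ))
      (by fun_prop : Continuous _).continuousOn fun p hp => ?_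
    have hp2 := hp.2
    rw [mem_closedBall, dist_zero_right] at hp2 ⊢
    exact (norm_scaled_le hε hε1 (hE _) p.2).trans (by gcongr)
  have hcub : Continuous fun p : ℝ × (ℂ × ℂ) => cubicPerturbation (u p.1) p.2 :=
    contDiff_cubicPerturbation.continuous.comp ((hu.comp continuous_fst).prodMk continuous_snd)
  refine (hcub.const_smul (ε : ℂ)).continuousOn.add ?_
  exact ((hinv.mul continuous_const).continuousOn.mul hS.fst).prodMk
    ((hinv.mul continuous_const).continuousOn.mul hS.snd)

lemma invJ_scaled (ε : ℝ) {z : ℂ} (hz : ‖z‖ = 1) (X : ℂ × ℂ) :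
    invJ (ε * (z * X.1), ε ^ 2 * (z * X.2)) = ε ^ 3 * invJ X := by
  have hzz : z * conj z = 1 := by rw [Complex.mul_conj, Complex.normSq_eq_norm_sq, hz]; simp
  have e : Complex.I * ((ε * (z * X.1)) * conj ((ε : ℂ) ^ 2 * (z * X.2))
      - conj ((ε : ℂ) * (z * X.1)) * (ε ^ 2 * (z * X.2))) =
      ((ε ^ 3 : ℝ) : ℂ) * (Complex.I * (X.1 * conj X.2 - conj X.1 * X.2)) := by
    simp only [map_mul, map_pow, Complex.conj_ofReal]
    push_cast
    linear_combination (ε ^ 3 * Complex.I * (X.1 * conj X.2 - conj X.1 * X.2)) * hzz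
  unfold invJ
  rw [e, Complex.re_ofReal_mul]

/-- A solution of the envelope equation yields, after modulation, a solution of the normal form. -/
lemma hasDerivAt_modulate {k₀ ε p s r w : ℝ} {P Q : AffineFamily} {c : ℝ} (hε : 0 < ε)
    (hP : P.a₀ (c, 0) = p) (hQ : Q.a₀ (c, 0) = ε ^ 2) {E : ℝ → ℂ} (hE : ∀ ξ, ‖E ξ‖ = 1)
    {u : ℝ → Fin 5 → ℝ} {ρ : (ℂ × ℂ) × ℝ × ℝ → ℂ × ℂ} {X : ℝ → ℂ × ℂ} {ξ : ℝ}
    (hw : u (ε * ξ) =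
      ![P.a₁ (c, 0), ε * P.a₂ (c, 0), r * w, (Q.a₁ (c, 0) - s) / ε, Q.a₂ (c, 0)])
    (hEd : HasDerivAt E (Complex.I * (k₀ + p + r * (ε ^ 2 * w) : ℝ) * E ξ) ξ)
    (hX : HasDerivAt X (((X (ε * ξ)).2, (X (ε * ξ)).1 +
      s * ((X (ε * ξ)).1 * conj (X (ε * ξ)).1) * (X (ε * ξ)).1)
      + envelopePerturbation ε E u (fun Y => ρ (Y, c, 0)) (ε * ξ) (X (ε * ξ))) (ε * ξ)) :
    HasDerivAt (modulate ε E X) (fullField k₀ P Q ρ (modulate ε E X ξ) c 0) ξ := by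
  have hl : HasDerivAt (fun ξ : ℝ => ε * ξ) ε ξ := by simpa using (hasDerivAt_id ξ).const_mul ε
  have hXc := hX.scomp ξ hl
  have h1 := (hEd.fun_mul hXc.fst).const_mul (ε : ℂ)
  have h2 := (hEd.fun_mul hXc.snd).const_mul ((ε : ℂ) ^ 2)
  refine (h1.prodMk h2).congr_deriv ?_
  have hε0 : (ε : ℂ) ≠ 0 := by exact_mod_cast hε.ne'
  have hE0 : E ξ ≠ 0 := fun h => by simpa [h] using hE ξ
  have hJ := invJ_scaled ε (hE ξ) (X (ε * ξ))
  have hN : ‖(ε : ℂ) * (E ξ * (X (ε * ξ)).1)‖ ^ 2 = ε ^ 2 * ‖(X (ε * ξ)).1‖ ^ 2 := by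
    rw [norm_mul, norm_mul, hE, Complex.norm_real, Real.norm_eq_abs, abs_of_pos hε]
    ring
  have hn : (X (ε * ξ)).1 * conj (X (ε * ξ)).1 = ((‖(X (ε * ξ)).1‖ ^ 2 : ℝ) : ℂ) := by
    rw [Complex.mul_conj, Complex.normSq_eq_norm_sq]
  have hdiv : ε * ξ / ε = ξ := by field_simp
  simp only [Function.comp_apply, fullField, cubicField, modulate, AffineFamily.eval,
    envelopePerturbation, cubicPerturbation, hw, hP, hQ, hJ, hN, hn, hdiv]
  generalize X (ε * ξ) = x
  generalize ρ ((_, _), _) = y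
  ext1
  · simp
    field_simp
    ring
  · simp
    field_simp
    ring

/-! ### Extension to the whole line by reversibility -/

/-- The reverser as a continuous real-linear map. -/
def reverserCLM : (ℂ × ℂ) →L[ℝ] (ℂ × ℂ) :=
  ((Complex.conjCLE : ℂ →L[ℝ] ℂ).comp (ContinuousLinearMap.fst ℝ ℂ ℂ)).prod
    (-((Complex.conjCLE : ℂ →L[ℝ] ℂ).comp (ContinuousLinearMap.snd ℝ ℂ ℂ)))

lemma reverserCLM_apply (X : ℂ × ℂ) : reverserCLM X = reverser X := rfl

lemma reverser_reverser (X : ℂ × ℂ) : reverser (reverser X) = X := by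
  simp [reverser]

lemma norm_reverser (X : ℂ × ℂ) : ‖reverser X‖ = ‖X‖ := by
  simp [reverser, Prod.norm_def]

/-- Extension of a curve on the half line by reversibility. -/
def reflect (Y : ℝ → ℂ × ℂ) (ξ : ℝ) : ℂ × ℂ :=
  if 0 ≤ ξ then Y ξ else reverser (Y (-ξ))

lemma reflect_of_nonneg (Y : ℝ → ℂ × ℂ) {ξ : ℝ} (h : 0 ≤ ξ) : reflect Y ξ = Y ξ := if_pos h

lemma reflect_of_nonpos {Y : ℝ → ℂ × ℂ} (h0 : reverser (Y 0) = Y 0) {ξ : ℝ} (h : ξ ≤ 0) :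
    reflect Y ξ = reverser (Y (-ξ)) := by
  rcases h.lt_or_eq with h | rfl
  · exact if_neg h.not_ge
  · simp [reflect, h0]

lemma isReversible_reflect {Y : ℝ → ℂ × ℂ} (h0 : reverser (Y 0) = Y 0) :
    IsReversible (reflect Y) := by
  intro ξ
  rcases le_total 0 ξ with h | h
  · rw [reflect_of_nonneg Y h, reflect_of_nonpos h0 (neg_nonpos.2 h), neg_neg]
  · rw [reflect_of_nonneg Y (neg_nonneg.2 h), reflect_of_nonpos h0 h, reverser_reverser]

/-- Anticommutation of the field with the reverser makes the reflected half a solution. At `0` the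
two halves meet because `Y 0` is fixed, and both one-sided derivatives equal `F (Y 0)`. -/
lemma hasDerivAt_reflect {Y : ℝ → ℂ × ℂ} {F : ℂ × ℂ → ℂ × ℂ} (h0 : reverser (Y 0) = Y 0)
    (hY : ∀ ξ, 0 ≤ ξ → HasDerivAt Y (F (Y ξ)) ξ)
    (hF : ∀ ξ, 0 ≤ ξ → F (reverser (Y ξ)) = -reverser (F (Y ξ))) (ξ : ℝ) :
    HasDerivAt (reflect Y) (F (reflect Y ξ)) ξ := by
  have hleft : ∀ ξ, ξ ≤ 0 →
      HasDerivAt (fun ξ => reverser (Y (-ξ))) (F (reflect Y ξ)) ξ := by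
    intro ξ hξ
    rw [reflect_of_nonpos h0 hξ, hF _ (neg_nonneg.2 hξ)]
    have h1 := (hY _ (neg_nonneg.2 hξ)).scomp ξ (hasDerivAt_neg ξ)
    have h2 := reverserCLM.hasFDerivAt.comp_hasDerivAt ξ h1
    refine h2.congr_deriv ?_
    rw [map_smul, reverserCLM_apply, neg_one_smul]
  have hright : ∀ ξ, 0 ≤ ξ → HasDerivAt Y (F (reflect Y ξ)) ξ := by
    intro ξ hξ
    rw [reflect_of_nonneg Y hξ]
    exact hY ξ hξ
  rcases lt_trichotomy ξ 0 with h | rfl | h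
  · refine (hleft ξ h.le).congr_of_eventuallyEq ?_
    filter_upwards [gt_mem_nhds h] with x hx using reflect_of_nonpos h0 (le_of_lt hx)
  · rw [← hasDerivWithinAt_univ, ← Iic_union_Ici (a := (0 : ℝ))]
    refine HasDerivWithinAt.union ?_ ?_
    · exact (hleft 0 le_rfl).hasDerivWithinAt.congr (fun x hx => reflect_of_nonpos h0 hx)
        (reflect_of_nonpos h0 le_rfl)
    · exact (hright 0 le_rfl).hasDerivWithinAt.congr (fun x hx => reflect_of_nonneg Y hx)
        (reflect_of_nonneg Y le_rfl)
  · refine (hright ξ h.le).congr_of_eventuallyEq ?_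
    filter_upwards [lt_mem_nhds h] with x hx using reflect_of_nonneg Y (le_of_lt hx)

lemma tendsto_atBot_of_isReversible {X : ℝ → ℂ × ℂ} (hX : IsReversible X)
    (h : Tendsto X atTop (𝓝 0)) : Tendsto X atBot (𝓝 0) := by
  have h1 : Tendsto (fun ξ => X (-ξ)) atBot (𝓝 0) := h.comp tendsto_neg_atBot_atTop
  rw [tendsto_zero_iff_norm_tendsto_zero] at h1 ⊢
  refine h1.congr fun ξ => ?_
  rw [hX, norm_reverser]

/-! ### The carrier and the explicit wave -/

/-- The carrier wave of the sech homoclinic. -/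
def carrier (k₀ σ π₀ r s θ ξ : ℝ) : ℂ :=
  Complex.exp (Complex.I * ((k₀ * ξ + phase σ π₀ r s ξ + θ : ℝ) : ℂ))

lemma norm_carrier (k₀ σ π₀ r s θ ξ : ℝ) : ‖carrier k₀ σ π₀ r s θ ξ‖ = 1 := by
  rw [carrier, mul_comm, Complex.norm_exp_ofReal_mul_I]

lemma carrier_zero (k₀ σ π₀ r s θ : ℝ) :
    carrier k₀ σ π₀ r s θ 0 = Complex.exp (Complex.I * (θ : ℂ)) := by
  simp [carrier, phase]

lemma conj_exp_I_mul {θ : ℝ} (hθ : Real.sin θ = 0) :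
    Complex.exp (Complex.I * (-θ : ℝ)) = Complex.exp (Complex.I * θ) := by
  rw [mul_comm, mul_comm Complex.I, Complex.exp_mul_I, Complex.exp_mul_I]
  simp [← Complex.ofReal_sin, hθ]

/-- The phase without `θ` is odd, so the symmetry reduces to `exp (iθ)` being real; this selects `θ
= 0` and `θ = π` modulo `2π`. -/
lemma carrier_neg (k₀ σ π₀ r s : ℝ) {θ : ℝ} (hθ : Real.sin θ = 0) (ξ : ℝ) :
    carrier k₀ σ π₀ r s θ (-ξ) = conj (carrier k₀ σ π₀ r s θ ξ) := by
  have h := conj_exp_I_mul hθ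
  unfold carrier
  rw [← Complex.exp_conj, map_mul, Complex.conj_I, Complex.conj_ofReal]
  have e1 : Complex.I * ((k₀ * -ξ + phase σ π₀ r s (-ξ) + θ : ℝ) : ℂ) =
      Complex.I * ((-(k₀ * ξ + phase σ π₀ r s ξ) : ℝ) : ℂ) + Complex.I * θ := by
    simp only [phase, mul_neg, Real.tanh_neg]
    push_cast
    ring
  have e2 : -Complex.I * ((k₀ * ξ + phase σ π₀ r s ξ + θ : ℝ) : ℂ) =
      Complex.I * ((-(k₀ * ξ + phase σ π₀ r s ξ) : ℝ) : ℂ) + Complex.I * (-θ : ℝ) := by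
    push_cast
    ring
  rw [e1, e2, Complex.exp_add, Complex.exp_add, h]

lemma hasDerivAt_tanh (t : ℝ) : HasDerivAt Real.tanh ((Real.cosh t)⁻¹ ^ 2) t := by
  have h := (Real.hasDerivAt_sinh t).fun_div (Real.hasDerivAt_cosh t) (Real.cosh_pos t).ne'
  have e : Real.tanh = fun t => Real.sinh t / Real.cosh t := funext Real.tanh_eq_sinh_div_cosh
  rw [e]
  refine h.congr_deriv ?_
  have := Real.cosh_sq t
  have hc := (Real.cosh_pos t).ne'
  field_simp
  linear_combination this

/-- Since `-2 / s = m²`, the derivative of the `tanh` term in the phase is exactly `r` times the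
squared amplitude. -/
lemma hasDerivAt_carrier (k₀ σ π₀ r s θ ξ : ℝ) {ε m : ℝ} (hσ : √σ = ε) (hms : s * m ^ 2 = -2) :
    HasDerivAt (carrier k₀ σ π₀ r s θ)
      (Complex.I * (k₀ + π₀ + r * (ε ^ 2 * (m * (Real.cosh (ε * ξ))⁻¹) ^ 2) : ℝ) *
        carrier k₀ σ π₀ r s θ ξ) ξ := by
  have hs : s ≠ 0 := by rintro rfl; norm_num at hms
  have hl : HasDerivAt (fun ξ : ℝ => ε * ξ) ε ξ := by simpa using (hasDerivAt_id ξ).const_mul ε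
  have ht := (((hasDerivAt_tanh (ε * ξ)).comp ξ hl).const_mul (2 * (r / s) * ε))
  have hp : HasDerivAt (fun ξ => k₀ * ξ + phase σ π₀ r s ξ + θ)
      (k₀ + π₀ + r * (ε ^ 2 * (m * (Real.cosh (ε * ξ))⁻¹) ^ 2)) ξ := by
    have h1 := ((((hasDerivAt_id' ξ).const_mul k₀).fun_add
      (((hasDerivAt_id' ξ).const_mul π₀).fun_sub ht)).add_const θ)
    simp only [phase, hσ]
    refine h1.congr_deriv ?_
    have hm : m ^ 2 = -2 / s := by field_simp; linarith
    rw [mul_pow m, hm]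
    field_simp
    ring
  refine (hp.ofReal_comp.const_mul Complex.I).cexp.congr_deriv ?_
  rw [mul_comm]
  rfl

lemma sechHomoclinic_eq_modulate (k₀ π₀ r s θ : ℝ) {σ ε : ℝ} (hσ : √σ = ε)
    (hs : s < 0) :
    sechHomoclinic k₀ σ π₀ r s θ =
      modulate ε (carrier k₀ σ π₀ r s θ) (profile √(2 / (-s))) := by
  have ha : amplitude σ s = fun ξ => ε * (√(2 / (-s)) * (Real.cosh (ε * ξ))⁻¹) := by
    funext ξ
    rw [amplitude, hσ, div_eq_mul_inv, show 2 * σ / (-s) = (2 / (-s)) * σ by ring,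
      Real.sqrt_mul (by have : 0 < -s := by linarith
                        positivity), hσ]
    ring
  have hd : ∀ ξ, deriv (amplitude σ s) ξ = ε ^ 2 * -(√(2 / (-s)) *
      (Real.sinh (ε * ξ) * (Real.cosh (ε * ξ))⁻¹ ^ 2)) := by
    intro ξ
    have hl : HasDerivAt (fun ξ : ℝ => ε * ξ) ε ξ := by simpa using (hasDerivAt_id ξ).const_mul ε
    rw [ha]
    refine ((((hasDerivAt_inv_cosh (ε * ξ)).comp ξ hl).const_mul _).const_mul _).deriv.trans ?_
    ring
  funext ξ
  simp only [sechHomoclinic, modulate, profile, hd]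
  rw [ha]
  unfold carrier
  ext1
  · push_cast; ring
  · push_cast; ring

lemma modulate_neg (ε : ℝ) {E : ℝ → ℂ} {X : ℝ → ℂ × ℂ} (hE : ∀ ξ, E (-ξ) = conj (E ξ))
    {ξ : ℝ} (hX : X (-(ε * ξ)) = reverser (X (ε * ξ))) :
    modulate ε E X (-ξ) = reverser (modulate ε E X ξ) := by
  simp only [modulate, mul_neg, hX, hE, reverser, map_mul, map_pow, Complex.conj_ofReal]

lemma profile_neg (m t : ℝ) : profile m (-t) = reverser (profile m t) := by
  simp [profile, reverser, -Complex.ofReal_inv, -Complex.ofReal_mul, Complex.conj_ofReal]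

lemma norm_modulate_sub_le {ε : ℝ} (hε : 0 < ε) (hε1 : ε ≤ 1) {E : ℝ → ℂ} (hE : ∀ ξ, ‖E ξ‖ = 1)
    (X Y : ℝ → ℂ × ℂ) (ξ : ℝ) :
    ‖modulate ε E X ξ - modulate ε E Y ξ‖ ≤ ε * ‖X (ε * ξ) - Y (ε * ξ)‖ := by
  have e : modulate ε E X ξ - modulate ε E Y ξ =
      ((ε * (E ξ * (X (ε * ξ) - Y (ε * ξ)).1), ε ^ 2 * (E ξ * (X (ε * ξ) - Y (ε * ξ)).2)) :
        ℂ × ℂ) := by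
    simp only [modulate, Prod.mk_sub_mk, Prod.fst_sub, Prod.snd_sub]
    ext1 <;> ring
  rw [e]
  exact norm_scaled_le hε hε1 (hE ξ) _

/-! ### Existence of reversible solutions near the explicit waves -/

/-- The only delicate entry is `(b₁ - s) / ε`: it stays bounded because `|b₁ - s| ≤ KQ d` and `κ d ≤
ε²`. -/
lemma norm_coefficients_le {ε m κ d KP KQ r f s g a₁ a₂ b₁ b₂ : ℝ} (hε : 0 < ε) (hε1 : ε ≤ 1)
    (hm : 0 ≤ m) (hκ : 0 < κ) (hd1 : d ≤ 1) (hKP : 0 ≤ KP) (hKQ : 0 ≤ KQ)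
    (hκd : κ * d ≤ ε ^ 2) (hP1 : |a₁ - r| ≤ KP * d) (hP2 : |a₂ - f| ≤ KP * d)
    (hQ1 : |b₁ - s| ≤ KQ * d) (hQ2 : |b₂ - g| ≤ KQ * d) (t : ℝ) :
    ‖![a₁, ε * a₂, r * (m * (Real.cosh t)⁻¹) ^ 2, (b₁ - s) / ε, b₂]‖ ≤
      |r| + KP + (|f| + KP) + |r| * m ^ 2 + KQ / κ + (|g| + KQ) := by
  have hKPc : KP * d ≤ KP := mul_le_of_le_one_right hKP hd1
  have hKQc : KQ * d ≤ KQ := mul_le_of_le_one_right hKQ hd1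
  have n1 : 0 ≤ |r| * m ^ 2 := by positivity
  have n2 : 0 ≤ KQ / κ := by positivity
  have n3 := abs_nonneg r
  have n4 := abs_nonneg f
  have n5 := abs_nonneg g
  have b1 : |a₁| ≤ |r| + KP := by
    have := abs_sub_abs_le_abs_sub (a₁) r
    linarith
  have b2 : |ε * a₂| ≤ |f| + KP := by
    have := abs_sub_abs_le_abs_sub (a₂) f
    rw [abs_mul, abs_of_pos hε]
    exact (mul_le_of_le_one_left (abs_nonneg _) hε1).trans (by linarith)
  have b3 : |r * (m * (Real.cosh t)⁻¹) ^ 2| ≤ |r| * m ^ 2 := by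
    rw [abs_mul, abs_of_nonneg (sq_nonneg (m * (Real.cosh t)⁻¹))]
    have h0 := inv_nonneg.2 (Real.cosh_pos t).le
    gcongr
    exact mul_le_of_le_one_right hm (inv_cosh_le_one t)
  have b4 : |(b₁ - s) / ε| ≤ KQ / κ := by
    rw [abs_div, abs_of_pos hε, div_le_div_iff₀ hε hκ]
    calc |b₁ - s| * κ ≤ KQ * d * κ := by gcongr
      _ = KQ * (κ * d) := by ring
      _ ≤ KQ * (ε * ε) := by rw [← pow_two]; gcongr
      _ ≤ KQ * (1 * ε) := by gcongr
      _ = KQ * ε := by ring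
  have b5 : |b₂| ≤ |g| + KQ := by
    have := abs_sub_abs_le_abs_sub (b₂) g
    linarith
  refine (pi_norm_le_iff_of_nonneg (by positivity)).2 fun i => ?_
  rw [Real.norm_eq_abs]
  fin_cases i
  · exact b1.trans (by linarith)
  · exact b2.trans (by linarith)
  · exact b3.trans (by linarith)
  · exact b4.trans (by linarith)
  · exact b5.trans (by linarith)
/-- An envelope on the half line which is close to the sech profile yields, by modulation and
reflection, a reversible homoclinic solution. -/
lemma exists_reversible_of_envelope {k₀ c ε m K R : ℝ} {P Q : AffineFamily}
    {ρ : (ℂ × ℂ) × ℝ × ℝ → ℂ × ℂ} {U : Set (ℂ × ℂ)} {E : ℝ → ℂ} {X : ℝ → ℂ × ℂ}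
    (hε : 0 < ε) (hε1 : ε ≤ 1) (hm : 0 ≤ m) (hK : 0 ≤ K) (hE : ∀ ξ, ‖E ξ‖ = 1)
    (hE_neg : ∀ ξ, E (-ξ) = conj (E ξ)) (hballU : closedBall (0 : ℂ × ℂ) (ε * R) ⊆ U)
    (hrev : ∀ Y ∈ U, reverser Y ∈ U →
      fullField k₀ P Q ρ (reverser Y) c 0 = -reverser (fullField k₀ P Q ρ Y c 0))
    (hYd : ∀ ξ, 0 ≤ ξ →
      HasDerivAt (modulate ε E X) (fullField k₀ P Q ρ (modulate ε E X ξ) c 0) ξ)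
    (hXim : (X 0).1.im = 0) (hXre : (X 0).2.re = 0)
    (hXe : ∀ t, 0 ≤ t → ‖X t - profile m t‖ ≤ K * Real.exp (-t / 2))
    (hXb : ∀ t, 0 ≤ t → X t ∈ closedBall (0 : ℂ × ℂ) R) :
    ∃ Y : ℝ → ℂ × ℂ, IsSolution k₀ P Q ρ U c 0 Y ∧ IsReversible Y ∧ Tendsto Y atTop (𝓝 0) ∧
      ∀ ξ, ‖Y ξ - modulate ε E (profile m) ξ‖ ≤ ε * K := by
  set Y := modulate ε E X with hYdef
  have hpos : ∀ {ξ : ℝ}, 0 ≤ ξ → 0 ≤ ε * ξ := fun h => mul_nonneg hε.le h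
  have hY0 : reverser (Y 0) = Y 0 := by
    have hX0 : X 0 = reverser (X 0) :=
      Prod.ext (Complex.ext (by simp [reverser]) (by simp [reverser, hXim]))
        (Complex.ext (by simp [reverser, hXre]) (by simp [reverser]))
    have := modulate_neg ε hE_neg (X := X) (ξ := 0) (by simpa using hX0)
    simpa using this.symm
  have hYn : ∀ ξ, ‖Y ξ‖ ≤ ε * ‖X (ε * ξ)‖ := fun ξ => norm_scaled_le hε hε1 (hE ξ) _
  have hYb : ∀ ξ, 0 ≤ ξ → ‖Y ξ‖ ≤ ε * R := fun ξ hξ => by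
    refine (hYn ξ).trans ?_
    have := hXb (ε * ξ) (hpos hξ)
    rw [mem_closedBall, dist_zero_right] at this
    gcongr
  have hYU : ∀ ξ, 0 ≤ ξ → Y ξ ∈ U := fun ξ hξ => hballU (by simpa using hYb ξ hξ)
  have hYU' : ∀ ξ, 0 ≤ ξ → reverser (Y ξ) ∈ U := fun ξ hξ =>
    hballU (by simpa [norm_reverser] using hYb ξ hξ)
  have hYt : Tendsto Y atTop (𝓝 0) := by
    have hexp : Tendsto (fun ξ => (2 * m + K) * Real.exp (-(ε * ξ) / 2)) atTop (𝓝 0) := by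
      rw [← mul_zero (2 * m + K)]
      refine (Real.tendsto_exp_atBot.comp ?_).const_mul _
      have : Tendsto (fun ξ : ℝ => -(ε / 2) * ξ) atTop atBot :=
        tendsto_id.const_mul_atTop_of_neg (by linarith)
      exact this.congr fun ξ => by ring
    refine squeeze_zero_norm' ?_ hexp
    filter_upwards [eventually_ge_atTop 0] with ξ hξ
    have h1 := hXe (ε * ξ) (hpos hξ)
    have h2 := (norm_profile_le hm (ε * ξ)).trans
      (mul_le_mul_of_nonneg_left (inv_cosh_le (ε * ξ)) hm)
    have h3 : Real.exp (-(ε * ξ)) ≤ Real.exp (-(ε * ξ) / 2) :=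
      Real.exp_le_exp.2 (by linarith [hpos hξ])
    have h4 : ‖X (ε * ξ)‖ ≤ ‖X (ε * ξ) - profile m (ε * ξ)‖ + ‖profile m (ε * ξ)‖ := by
      simpa using norm_add_le (X (ε * ξ) - profile m (ε * ξ)) (profile m (ε * ξ))
    have h5 := (hYn ξ).trans (mul_le_of_le_one_left (norm_nonneg _) hε1)
    have h6 : m * (2 * Real.exp (-(ε * ξ))) ≤ m * (2 * Real.exp (-(ε * ξ) / 2)) := by gcongr
    linarith
  have hdist : ∀ ξ, 0 ≤ ξ → ‖Y ξ - modulate ε E (profile m) ξ‖ ≤ ε * K := fun ξ hξ => by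
    refine (norm_modulate_sub_le hε hε1 hE X _ ξ).trans ?_
    have h2 : Real.exp (-(ε * ξ) / 2) ≤ 1 := by
      rw [Real.exp_le_one_iff]
      linarith [hpos hξ]
    exact mul_le_mul_of_nonneg_left
      ((hXe (ε * ξ) (hpos hξ)).trans (mul_le_of_le_one_right hK h2)) hε.le
  refine ⟨reflect Y, fun ξ => ⟨?_, hasDerivAt_reflect (F := fun Y => fullField k₀ P Q ρ Y c 0) hY0
    hYd (fun ξ hξ => hrev _ (hYU ξ hξ) (hYU' ξ hξ)) ξ⟩, isReversible_reflect hY0, ?_, fun ξ => ?_⟩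
  · rcases le_total 0 ξ with h | h
    · rw [reflect_of_nonneg Y h]
      exact hYU ξ h
    · rw [reflect_of_nonpos hY0 h]
      exact hYU' _ (neg_nonneg.2 h)
  · refine hYt.congr' ?_
    filter_upwards [eventually_ge_atTop 0] with ξ hξ using (reflect_of_nonneg Y hξ).symm
  · rcases le_total 0 ξ with h | h
    · rw [reflect_of_nonneg Y h]
      exact hdist ξ h
    · have h2 : modulate ε E (profile m) ξ = reverser (modulate ε E (profile m) (-ξ)) := by
        rw [← modulate_neg ε hE_neg (profile_neg _ _), neg_neg]
      rw [reflect_of_nonpos hY0 h, h2, ← reverserCLM_apply, ← reverserCLM_apply, ← map_sub,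
        reverserCLM_apply, norm_reverser]
      exact hdist (-ξ) (neg_nonneg.2 h)

/-- Existence of a reversible solution close to the sech homoclinic with phase `θ`, `sin θ = 0`,
just above the critical speed. -/
theorem exists_reversible_near_sechHomoclinic
    {cs k₀ : ℝ} (hcrit : IsCriticalPair cs k₀) {U : Set (ℂ × ℂ)} {V Z : Set ℝ}
    (hU : IsOpen U) (hU0 : (0 : ℂ × ℂ) ∈ U) (hV : IsOpen V) (hVc : cs ∈ V)
    (hZ : IsOpen Z) (hZ0 : (0 : ℝ) ∈ Z) {p₀ s₀ : ℝ → ℝ} (hunf : IsUnfolding cs k₀ V p₀ s₀)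
    {r f s g : ℝ} (hs : s < 0) {P Q : AffineFamily} {ρ : (ℂ × ℂ) × ℝ × ℝ → ℂ × ℂ}
    (hnf : IsReversibleNormalForm cs k₀ p₀ s₀ r f s g U V Z P Q ρ)
    {θ : ℝ} (hθ : Real.sin θ = 0) :
    ∃ C > 0, ∀ᶠ c in 𝓝[>] cs, ∃ X : ℝ → ℂ × ℂ, IsSolution k₀ P Q ρ U c 0 X ∧ IsReversible X ∧
      Tendsto X atTop (𝓝 0) ∧
      ∀ ξ, ‖X ξ - sechHomoclinic k₀ (s₀ c) (p₀ c) r s θ ξ‖ ≤ C * s₀ c := by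
  set m : ℝ := √(2 / (-s)) with hmdef
  have hm : 0 < m := Real.sqrt_pos.2 (div_pos two_pos (neg_pos.2 hs))
  have hms : s * m ^ 2 = -2 := by
    have := hs.ne
    rw [hmdef, Real.sq_sqrt (div_pos two_pos (neg_pos.2 hs)).le]
    field_simp
  obtain ⟨K, hK, κ₀, hκ₀, hhalf⟩ := exists_halfLine_solution hm hms
  obtain ⟨KP, hKP, hP⟩ := hnf.expansion_P.coefficients
  obtain ⟨KQ, hKQ, hQ⟩ := hnf.expansion_Q.coefficients
  obtain ⟨κ, hκ, L, hL, hbounds⟩ := hcrit.unfolding_bounds hV hVc hunf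
  obtain ⟨B, hB⟩ := hnf.rem_bound.bound
  have hB' : ∀ᶠ x in 𝓝 ((0 : ℂ × ℂ), cs, (0 : ℝ)), x.2.2 = 0 → ‖ρ x‖ ≤ B * ‖x.1‖ ^ 4 := by
    refine Eventually.mono hB fun x hx h0 => ?_
    simpa [h0] using hx
  obtain ⟨Kρ, hKρ, Rρ, hRρ, hρ⟩ := exists_lipschitz_of_quartic (hU.prod (hV.prod hZ))
    (show ((0 : ℂ × ℂ), cs, (0 : ℝ)) ∈ U ×ˢ V ×ˢ Z from ⟨hU0, hVc, hZ0⟩)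
    (hnf.smooth_rem.of_le (by norm_num)) hB'
  obtain ⟨Rb, hRb, hball⟩ := Metric.nhds_basis_closedBall.mem_iff.1 (hU.mem_nhds hU0)
  have hρ0 : ∀ᶠ c in 𝓝 cs, ρ (0, c, 0) = 0 := by
    have hcont : ContinuousAt (fun c : ℝ => ((0 : ℂ × ℂ), c, (0 : ℝ))) cs := by fun_prop
    filter_upwards [hcont.eventually hB'] with c hc
    simpa using hc rfl
  set Lu : ℝ := |r| + KP + (|f| + KP) + |r| * m ^ 2 + KQ / κ + (|g| + KQ) with hLu
  obtain ⟨KN, hKN, hN⟩ := exists_lipschitz_cubicPerturbation Lu (m + 1)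
  set M : ℝ := KN + Kρ * (m + 1) ^ 3 with hMdef
  have hM : 0 < M := by positivity
  -- The thresholds on `ε` ensure, in order: `ε ≤ 1`, the Lipschitz bound for `ρ` on the ball of
  -- radius `ε (m + 1)`, inclusion of that ball in `U`, and the smallness needed for persistence.
  set η : ℝ := min 1 (min (Rρ / (m + 1)) (min (Rb / (m + 1)) (κ₀ / M))) with hη
  have hη0 : 0 < η := by positivity
  have hsc : Tendsto (fun c => √(s₀ c)) (𝓝 cs) (𝓝 0) := by
    have h1 := (hunf.smooth_s.contDiffAt (hV.mem_nhds hVc)).continuousAt.sqrt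
    rwa [ContinuousAt, hunf.s_crit, Real.sqrt_zero] at h1
  refine ⟨K * M, by positivity, ?_⟩
  have hev : ∀ᶠ c in 𝓝 cs, √(s₀ c) < η ∧ |c - cs| < Rρ ∧ |c - cs| < 1 ∧ ρ (0, c, 0) = 0 := by
    filter_upwards [hsc.eventually (gt_mem_nhds hη0), Metric.ball_mem_nhds cs hRρ,
      Metric.ball_mem_nhds cs one_pos, hρ0] with c h1 h2 h3 h4 using ⟨h1, h2, h3, h4⟩
  filter_upwards [hbounds, hP.filter_mono nhdsWithin_le_nhds, hQ.filter_mono nhdsWithin_le_nhds,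
    hev.filter_mono nhdsWithin_le_nhds, self_mem_nhdsWithin]
    with c ⟨hcV, hlow, hup⟩ ⟨hP0, hP1, hP2⟩ ⟨hQ0, hQ1, hQ2⟩ ⟨hεη, hcR, hc1, hρc⟩ hc
  have hcc : 0 < c - cs := sub_pos.2 hc
  rw [abs_of_pos hcc] at hP1 hP2 hQ1 hQ2 hc1
  have hs0 : 0 < s₀ c := (mul_pos hκ hcc).trans_le hlow
  set ε : ℝ := √(s₀ c) with hεdef
  have hε : 0 < ε := Real.sqrt_pos.2 hs0
  have hεsq : ε ^ 2 = s₀ c := Real.sq_sqrt hs0.le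
  have hε1 : ε ≤ 1 := hεη.le.trans (min_le_left _ _)
  have hεRρ : ε * (m + 1) ≤ Rρ := by
    rw [← le_div_iff₀ (by positivity)]
    exact hεη.le.trans ((min_le_right _ _).trans (min_le_left _ _))
  have hεRb : ε * (m + 1) ≤ Rb := by
    rw [← le_div_iff₀ (by positivity)]
    exact hεη.le.trans ((min_le_right _ _).trans ((min_le_right _ _).trans (min_le_left _ _)))
  have hεκ : M * ε ≤ κ₀ := by
    rw [mul_comm, ← le_div_iff₀ hM]
    exact hεη.le.trans ((min_le_right _ _).trans ((min_le_right _ _).trans (min_le_right _ _)))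
  set E : ℝ → ℂ := carrier k₀ (s₀ c) (p₀ c) r s θ with hEdef
  have hE : ∀ ξ, ‖E ξ‖ = 1 := norm_carrier _ _ _ _ _ _
  have hEd := fun ξ => hasDerivAt_carrier k₀ (s₀ c) (p₀ c) r s θ ξ hεdef.symm hms
  have hEc : Continuous E := continuous_iff_continuousAt.2 fun ξ => (hEd ξ).continuousAt
  -- The entries are what remains of the cubic terms after one factor `ε` is taken out: the third is
  -- the rotation already carried by `E`, the fourth the deviation of the cubic coefficient from its
  -- critical value `s`.
  let u : ℝ → Fin 5 → ℝ := fun t => ![P.a₁ (c, 0), ε * P.a₂ (c, 0),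
    r * (m * (Real.cosh t)⁻¹) ^ 2, (Q.a₁ (c, 0) - s) / ε, Q.a₂ (c, 0)]
  have hcosh : Continuous fun t : ℝ => (Real.cosh t)⁻¹ :=
    Real.continuous_cosh.inv₀ fun t => (Real.cosh_pos t).ne'
  have huc : Continuous u := by
    refine continuous_pi fun i => ?_
    fin_cases i
    · exact continuous_const
    · exact continuous_const
    · exact continuous_const.mul ((continuous_const.mul hcosh).pow 2)
    · exact continuous_const
    · exact continuous_const
  have hlow' : κ * (c - cs) ≤ ε ^ 2 := hεsq.symm ▸ hlow
  have huL : ∀ t, ‖u t‖ ≤ Lu := fun t => norm_coefficients_le hε hε1 hm.le hκ hc1.le hKP.le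
    hKQ.le hlow' hP1 hP2 hQ1 hQ2 t
  have hballU : closedBall (0 : ℂ × ℂ) (ε * (m + 1)) ⊆ U :=
    (closedBall_subset_closedBall hεRb).trans hball
  have hgc : ContinuousOn (fun Y => ρ (Y, c, 0)) (closedBall 0 (ε * (m + 1))) :=
    hnf.smooth_rem.continuousOn.comp (f := fun Y : ℂ × ℂ => (Y, c, (0 : ℝ)))
      (by fun_prop : Continuous _).continuousOn fun Y hY => ⟨hballU hY, hcV, hZ0⟩
  obtain ⟨X, hXd, hXim, hXre, hXe, hXb⟩ :=
    hhalf (envelopePerturbation ε E u fun Y => ρ (Y, c, 0)) (M * ε) (by positivity) hεκ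
      (continuousOn_envelopePerturbation hε hε1 hE hEc huc hgc)
      (fun t => by simp [envelopePerturbation, cubicPerturbation, ← Prod.zero_eq_mk, hρc])
      (fun t X hX Y hY => norm_envelopePerturbation_sub_le hε hε1 hE hKρ.le (by positivity) hX hY
        (hN (u t) (huL t) X hX Y hY) (hρ c hcR _ (by positivity) hεRρ))
  obtain ⟨Y, hYs, hYr, hYt, hYd⟩ := exists_reversible_of_envelope (P := P) (Q := Q) (ρ := ρ)
    (U := U) (E := E) (X := X) (m := m) (K := K * (M * ε)) (R := m + 1) hε hε1 hm.le (by positivity)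
    hE (carrier_neg _ _ _ _ _ hθ) hballU (fun Y hY hY' => hnf.reversible Y hY hY' c hcV 0 hZ0)
    (fun ξ hξ => hasDerivAt_modulate (s := s) (r := r) (w := (m * (Real.cosh (ε * ξ))⁻¹) ^ 2) hε hP0
      (hQ0.trans hεsq.symm) hE rfl (hEd ξ) (hXd (ε * ξ) (mul_nonneg hε.le hξ)))
    hXim hXre hXe hXb
  refine ⟨Y, hYs, hYr, hYt, fun ξ => ?_⟩
  rw [sechHomoclinic_eq_modulate k₀ (p₀ c) r s θ hεdef.symm hs]
  exact (hYd ξ).trans_eq (by linear_combination (K * M) * hεsq)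

end FPUNormalForm

end

/-! ### The two homoclinics, for phases `0` and `π` -/

open FPUNormalForm

theorem proposition4p3
    (cs k₀ : ℝ) (hcrit : FPUNormalForm.IsCriticalPair cs k₀)
    (U : Set (ℂ × ℂ)) (V Z : Set ℝ)
    (hU : IsOpen U) (hU0 : (0 : ℂ × ℂ) ∈ U)
    (hV : IsOpen V) (hVc : cs ∈ V)
    (hZ : IsOpen Z) (hZ0 : (0 : ℝ) ∈ Z)
    (p₀ s₀ : ℝ → ℝ) (hunf : FPUNormalForm.IsUnfolding cs k₀ V p₀ s₀)
    (r f s g : ℝ) (hs : s < 0)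
    (P Q : FPUNormalForm.AffineFamily) (ρ : (ℂ × ℂ) × ℝ × ℝ → ℂ × ℂ)
    (hnf : FPUNormalForm.IsReversibleNormalForm cs k₀ p₀ s₀ r f s g U V Z P Q ρ) :
    ∃ C > 0, ∃ δ > 0, ∀ c : ℝ, cs < c → c < cs + δ →
      c ∈ V ∧ 0 < s₀ c ∧
      ∃ X₀ Xπ : ℝ → ℂ × ℂ, X₀ ≠ Xπ ∧
        (FPUNormalForm.IsSolution k₀ P Q ρ U c 0 X₀ ∧
          FPUNormalForm.IsReversible X₀ ∧ FPUNormalForm.IsHomoclinicToZero X₀ ∧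
          ∀ ξ : ℝ,
            ‖(X₀ ξ).1 - (FPUNormalForm.sechHomoclinic k₀ (s₀ c) (p₀ c) r s 0 ξ).1‖
                ≤ C * |c - cs| ∧
            ‖(X₀ ξ).2 - (FPUNormalForm.sechHomoclinic k₀ (s₀ c) (p₀ c) r s 0 ξ).2‖
                ≤ C * |c - cs|) ∧
        (FPUNormalForm.IsSolution k₀ P Q ρ U c 0 Xπ ∧
          FPUNormalForm.IsReversible Xπ ∧ FPUNormalForm.IsHomoclinicToZero Xπ ∧
          ∀ ξ : ℝ,
            ‖(Xπ ξ).1 - (FPUNormalForm.sechHomoclinic k₀ (s₀ c) (p₀ c) r s Real.pi ξ).1‖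
                ≤ C * |c - cs| ∧
            ‖(Xπ ξ).2 - (FPUNormalForm.sechHomoclinic k₀ (s₀ c) (p₀ c) r s Real.pi ξ).2‖
                ≤ C * |c - cs|) := by
  obtain ⟨C₀, hC₀, h₀⟩ := exists_reversible_near_sechHomoclinic hcrit hU hU0 hV hVc hZ hZ0 hunf hs
    hnf Real.sin_zero
  obtain ⟨C₁, hC₁, h₁⟩ := exists_reversible_near_sechHomoclinic hcrit hU hU0 hV hVc hZ hZ0 hunf hs
    hnf Real.sin_pi
  obtain ⟨κ, hκ, L, hL, hbounds⟩ := hcrit.unfolding_bounds hV hVc hunf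
  set m : ℝ := √(2 / (-s)) with hmdef
  have hm : 0 < m := Real.sqrt_pos.2 (div_pos two_pos (neg_pos.2 hs))
  have hsc : Tendsto (fun c => √(s₀ c)) (𝓝 cs) (𝓝 0) := by
    have h1 := (hunf.smooth_s.contDiffAt (hV.mem_nhds hVc)).continuousAt.sqrt
    rwa [ContinuousAt, hunf.s_crit, Real.sqrt_zero] at h1
  -- This makes the errors `C₀ ε²` and `C₁ ε²` smaller than the amplitude `ε m` at `ξ = 0`, so the
  -- real parts of `A` there have opposite signs.
  have hsmall : ∀ᶠ c in 𝓝[>] cs, √(s₀ c) < m / (C₀ + C₁) :=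
    (hsc.eventually (gt_mem_nhds (by positivity))).filter_mono nhdsWithin_le_nhds
  have hall := (h₀.and h₁).and (hbounds.and hsmall)
  rw [eventually_nhdsWithin_iff, Metric.eventually_nhds_iff] at hall
  obtain ⟨δ, hδ, hall⟩ := hall
  refine ⟨(C₀ + C₁) * L, by positivity, δ, hδ, fun c hc hcδ => ?_⟩
  obtain ⟨⟨⟨X₀, sol₀, rev₀, lim₀, d₀⟩, X₁, sol₁, rev₁, lim₁, d₁⟩, ⟨hcV, hlow, hup⟩, hsm⟩ :=
    hall (y := c) (by rw [Real.dist_eq, abs_of_pos (by linarith)]; linarith) hc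
  have hs0 : 0 < s₀ c := (mul_pos hκ (sub_pos.2 hc)).trans_le hlow
  set ε : ℝ := √(s₀ c) with hεdef
  have hε : 0 < ε := Real.sqrt_pos.2 hs0
  have hεsq : ε ^ 2 = s₀ c := Real.sq_sqrt hs0.le
  have hsech : ∀ θ, (sechHomoclinic k₀ (s₀ c) (p₀ c) r s θ 0).1 =
      ((ε * m : ℝ) : ℂ) * Complex.exp (Complex.I * (θ : ℂ)) := fun θ => by
    rw [sechHomoclinic_eq_modulate k₀ (p₀ c) r s θ hεdef.symm hs]
    simp only [modulate, carrier_zero, profile, mul_zero, Real.cosh_zero]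
    push_cast
    ring
  have hsz : C₀ * s₀ c < ε * m ∧ C₁ * s₀ c < ε * m := by
    rw [lt_div_iff₀ (by positivity)] at hsm
    rw [← hεsq]
    constructor <;> nlinarith [mul_pos hε hC₀, mul_pos hε hC₁]
  have hre₀ : 0 < (X₀ 0).1.re := by
    have h1 := (Complex.abs_re_le_norm _).trans ((norm_fst_le _).trans (d₀ 0))
    rw [Prod.fst_sub, hsech] at h1
    simp only [Complex.ofReal_zero, mul_zero, Complex.exp_zero, mul_one, Complex.sub_re,
      Complex.ofReal_re] at h1
    linarith [(abs_le.1 h1).1, hsz.1]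
  have hre₁ : (X₁ 0).1.re < 0 := by
    have h1 := (Complex.abs_re_le_norm _).trans ((norm_fst_le _).trans (d₁ 0))
    rw [Prod.fst_sub, hsech, mul_comm Complex.I, Complex.exp_pi_mul_I] at h1
    simp only [mul_neg, mul_one, Complex.sub_re, Complex.neg_re, Complex.ofReal_re] at h1
    linarith [(abs_le.1 h1).2, hsz.2]
  have hne₀ : X₀ 0 ≠ 0 := fun h => by simp [h] at hre₀
  have hne₁ : X₁ 0 ≠ 0 := fun h => by simp [h] at hre₁
  have hbd : ∀ {C : ℝ}, 0 < C → C ≤ C₀ + C₁ → C * s₀ c ≤ (C₀ + C₁) * L * |c - cs| := by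
    intro C hC0 hC
    rw [abs_of_pos (sub_pos.2 hc), mul_assoc]
    gcongr
  refine ⟨hcV, hs0, X₀, X₁, fun h => ?_, ⟨sol₀, rev₀, ⟨⟨0, hne₀⟩, lim₀,
    tendsto_atBot_of_isReversible rev₀ lim₀⟩, fun ξ => ?_⟩, sol₁, rev₁, ⟨⟨0, hne₁⟩, lim₁,
    tendsto_atBot_of_isReversible rev₁ lim₁⟩, fun ξ => ?_⟩
  · rw [h] at hre₀
    linarith
  · have h := (d₀ ξ).trans (hbd hC₀ (by linarith))
    exact ⟨(norm_fst_le _).trans h, (norm_snd_le _).trans h⟩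
  · have h := (d₁ ξ).trans (hbd hC₁ (by linarith))
    exact ⟨(norm_fst_le _).trans h, (norm_snd_le _).trans h⟩
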